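/- Let $\mathbb D$ be the open unit disk of $\mathbb C$, $H(\mathbb D)$ the space of analytic functions on $\mathbb D$, $dA$ the normalized Lebesgue measure on $\mathbb D$, and $\alpha\in\mathbb R$. For $f\in H(\mathbb D)$ put $$\|f\|_{\mathfrak B_{\log^\alpha}}=|f(0)|+\sup_{z\in\mathbb D}(1-|z|)\Big(\log\frac2{1-|z|}\Big)^{-\alpha}|f'(z)|,\qquad \|f\|_{\mathfrak B^1_{\log^\alpha}}=|f(0)|+\int_{\mathbb D}|f'(z)|\Big(\log\frac2{1-|z|}\Big)^{\alpha}dA(z),$$ both with values in $[0,\infty]$. Let $\mathfrak B_{\log^\alpha}$, respectively $\mathfrak b_{\log^\alpha}$, be the set of all $f\in H(\mathbb D)$ such that $|f'(z)|$ is $O$, respectively $o$, of $(1-|z|)^{-1}\log^\alpha\frac2{1-|z|}$ as $|z|\to1^-$, and let $\mathfrak B^1_{\log^\alpha}$ be the set of all $f\in H(\mathbb D)$ with $\|f\|_{\mathfrak B^1_{\log^\alpha}}<\infty$. Let $\omega:\mathbb R\to\mathbb R$ be a $C^\infty$ function with $\omega(t)=1$ for $t\le1$, $\omega(t)=0$ for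 $t\ge2$, and $\omega$ decreasing and positive on $(1,2)$. Put $\varphi(t)=\omega(t/2)-\omega(t)$, $V_0(z)=1+z$ and, for $n\ge1$, $$V_n(z)=\sum_{k=2^{n-1}}^{2^{n+1}-1}\varphi\big(k/2^{n-1}\big)z^k.$$ Let $*$ denote the Hadamard product, $\big(\sum a_kz^k\big)*\big(\sum b_kz^k\big)=\sum a_kb_kz^k$, and let $$\|h\|_\infty=\sup_{z\in\mathbb D}|h(z)|,\qquad \|h\|_1=\sup_{0<r<1}\frac1{2\pi}\int_0^{2\pi}|h(re^{i\theta})|\,d\theta .$$ Then for every $f\in H(\mathbb D)$: (i) $f\in\mathfrak B_{\log^\alpha}$ if and only if $\sup_{n\ge0}(n+1)^{-\alpha}\|V_n*f\|_\infty<\infty$; (ii) $f\in\mathfrak b_{\log^\alpha}$ if and only if $\lim_{n\to\infty}(n+1)^{-\alpha}\|V_n*f\|_\infty=0$; (iii) $f\in\mathfrak B^1_{\log^\alpha}$ if and only if $\sum_{n=0}^\infty(n+1)^{\alpha}\|V_n*f\|_1<\infty$. Moreover, there is a constant $C\in(0,\infty)$, depending only on $\alpha$ and $\omega$, such that for every $f\in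 H(\mathbb D)$, as inequalities in $[0,\infty]$, $$C^{-1}\|f\|_{\mathfrak B_{\log^\alpha}}\le\sup_{n\ge0}(n+1)^{-\alpha}\|V_n*f\|_\infty\le C\|f\|_{\mathfrak B_{\log^\alpha}},$$ and likewise there is a constant $C\in(0,\infty)$, depending only on $\alpha$ and $\omega$, such that for every $f\in H(\mathbb D)$ $$C^{-1}\|f\|_{\mathfrak B^1_{\log^\alpha}}\le\sum_{n=0}^\infty(n+1)^{\alpha}\|V_n*f\|_1\le C\|f\|_{\mathfrak B^1_{\log^\alpha}}.$$ -/

import Mathlib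

open Set Filter Topology
open scoped NNReal ENNReal

namespace LogBloch

noncomputable section

/-- The open unit disk. -/
def disk : Set ℂ := Metric.ball 0 1

/-- `H(𝔻)`: functions analytic in the unit disk (values off the disk are irrelevant). -/
def IsHol (f : ℂ → ℂ) : Prop := DifferentiableOn ℂ f disk

/-- The weight `log^α (2 / (1 - |z|))`; the base is at least `log 2 > 0` on the disk. -/
def logWeight (α : ℝ) (z : ℂ) : ℝ := Real.log (2 / (1 - ‖z‖)) ^ α

/-- The filter `|z| → 1⁻`. -/
def boundaryFilter : Filter ℂ := comap (fun z : ℂ => ‖z‖) (𝓝[<] (1 : ℝ))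

/-- `f ∈ 𝔅_{log^α}`: `f` is analytic in the disk and
`|f'(z)| = O((1 - |z|)⁻¹ log^α (2 / (1 - |z|)))`. -/
def MemBloch (α : ℝ) (f : ℂ → ℂ) : Prop :=
  IsHol f ∧ deriv f =O[boundaryFilter] fun z => (1 - ‖z‖)⁻¹ * logWeight α z

/-- `f ∈ 𝔟_{log^α}`: the same with `o` in place of `O`. -/
def MemLittleBloch (α : ℝ) (f : ℂ → ℂ) : Prop :=
  IsHol f ∧ deriv f =o[boundaryFilter] fun z => (1 - ‖z‖)⁻¹ * logWeight α z

/-- The (extended-valued) norm of `𝔅_{log^α}`: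
`|f(0)| + sup_{z ∈ 𝔻} (1 - |z|) log^{-α} (2 / (1 - |z|)) |f'(z)|`. -/
def blochNorm (α : ℝ) (f : ℂ → ℂ) : ℝ≥0∞ :=
  ‖f 0‖ₑ + ⨆ z ∈ disk, ENNReal.ofReal ((1 - ‖z‖) * logWeight (-α) z) * ‖deriv f z‖ₑ

/-- The (extended-valued) norm of `𝔅¹_{log^α}`:
`|f(0)| + ∫_𝔻 |f'(z)| log^α (2 / (1 - |z|)) dA(z)`, with `dA` Lebesgue measure divided by `π`. -/
def blochOneNorm (α : ℝ) (f : ℂ → ℂ) : ℝ≥0∞ :=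
  ‖f 0‖ₑ + (ENNReal.ofReal Real.pi)⁻¹ *
    ∫⁻ z in disk, ‖deriv f z‖ₑ * ENNReal.ofReal (logWeight α z)

/-- `f ∈ 𝔅¹_{log^α}`. -/
def MemBlochOne (α : ℝ) (f : ℂ → ℂ) : Prop :=
  IsHol f ∧ blochOneNorm α f < ∞

/-- The norm of the Hardy space `H^∞`. -/
def hardyNormInf (h : ℂ → ℂ) : ℝ≥0∞ := ⨆ z ∈ disk, ‖h z‖ₑ

/-- The norm of the Hardy space `H¹`:
`sup_{0 < r < 1} (1 / 2π) ∫_0^{2π} |h(r e^{iθ})| dθ`. -/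
def hardyNormOne (h : ℂ → ℂ) : ℝ≥0∞ :=
  ⨆ r ∈ Ioo (0 : ℝ) 1, (ENNReal.ofReal (2 * Real.pi))⁻¹ *
    ∫⁻ θ in Ioc (0 : ℝ) (2 * Real.pi), ‖h (r * Complex.exp (θ * Complex.I))‖ₑ

/-- The Taylor coefficient `f̂(k)` at the origin. -/
def taylorCoeff (f : ℂ → ℂ) (k : ℕ) : ℂ := iteratedDeriv k f 0 / (k.factorial : ℂ)

/-- The Hadamard product `(f * g)(z) = ∑ f̂(k) ĝ(k) z^k`. -/
def hadamard (f g : ℂ → ℂ) (z : ℂ) : ℂ := ∑' k : ℕ, taylorCoeff f k * taylorCoeff g k * z ^ k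

/-- The cutoff functions `ω` from which the polynomials `V_n` are built. -/
structure IsCutoff (ω : ℝ → ℝ) : Prop where
  smooth : ContDiff ℝ ((⊤ : ℕ∞) : WithTop ℕ∞) ω
  eq_one : ∀ t : ℝ, t ≤ 1 → ω t = 1
  eq_zero : ∀ t : ℝ, 2 ≤ t → ω t = 0
  antitone : AntitoneOn ω (Ioo 1 2)
  pos : ∀ t ∈ Ioo (1 : ℝ) 2, 0 < ω t

/-- `φ(t) = ω(t/2) - ω(t)`. -/
def phi (ω : ℝ → ℝ) (t : ℝ) : ℝ := ω (t / 2) - ω t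

/-- `V_0(z) = 1 + z` and `V_n(z) = ∑_{k = 2^(n-1)}^{2^(n+1) - 1} φ(k / 2^(n-1)) z^k` for `n ≥ 1`. -/
def V (ω : ℝ → ℝ) : ℕ → ℂ → ℂ
  | 0, z => 1 + z
  | n + 1, z =>
    ∑ k ∈ Finset.Ico (2 ^ n : ℕ) (2 ^ (n + 2) : ℕ), (phi ω ((k : ℝ) / 2 ^ n) : ℂ) * z ^ k

/-- `(n + 1)^(-α) ‖V_n * f‖_∞`. -/
def blockInf (ω : ℝ → ℝ) (α : ℝ) (f : ℂ → ℂ) (n : ℕ) : ℝ≥0∞ :=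
  ENNReal.ofReal (((n : ℝ) + 1) ^ (-α)) * hardyNormInf (hadamard (V ω n) f)

/-- `(n + 1)^α ‖V_n * f‖_1`. -/
def blockOne (ω : ℝ → ℝ) (α : ℝ) (f : ℂ → ℂ) (n : ℕ) : ℝ≥0∞ :=
  ENNReal.ofReal (((n : ℝ) + 1) ^ α) * hardyNormOne (hadamard (V ω n) f)

end

end LogBloch

/-! Coefficients are taken in a Banach space `E`, so that one argument serves both norms: `E = ℂ`
gives `H^∞`, and `E = L¹` of the circle gives `H¹`, through the function `w ↦ (t ↦ f (w e^{it}))`.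
Everything rests on one estimate (`exists_integral_dilatedKernel_le`): the kernels `∑ ψ(k/N)
e^{ikθ}` have `L¹` norms bounded uniformly in `N`, so the multipliers `ψ(k/N)` are uniformly
bounded.

A profile that inverts `z d/dz` and a change of radius shows that `V_{n+1} * F` is at most a
constant times `2^{-n}` times the size of `z F'` on a circle with `1 - |z| ≈ 2^{-n}`
(`exists_norm_block_succ_le`). Conversely, a block obeys Bernstein's inequality and, for `n ≥ 1`,
vanishes to order at least `2^{n-1}` at the origin, so `z (V_n * F)'` is at most a constant times
`2^n exp(-2^n (1 - |z|) / 2) ‖V_n * F‖` (`exists_norm_block_deriv_le`). These functions sum to `z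
F'` because the `V_n` telescope.

Where `1 - |z| ≈ 2^{-m}` the logarithm is comparable to `m + 1`, and the weighted Bernstein bounds
are dominated by the convolution kernel `2^{-|n-m|} (1 + |n-m|)^p` with `p ≥ |α|` (`weight_mul_le`).
Its row and column sums are bounded, so it acts on `ℓ^∞`, `c₀` and `ℓ¹`; these three actions give
`𝔅`, `𝔟` and `𝔅¹`. For `𝔅¹`, polar coordinates reduce the area integral to a radial one, which is
cut into dyadic intervals. -/

namespace LogBloch

/-! ### `L¹` bounds for dilated trigonometric kernels. -/

section Kernels

/-- A `C²` function with compact support is bounded together with its second derivative. -/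
lemma exists_bound_deriv_two {ψ : ℝ → ℝ} (hψ : ContDiff ℝ 2 ψ) (hc : HasCompactSupport ψ) :
    ∃ A : ℝ, 0 ≤ A ∧ (∀ t, |ψ t| ≤ A) ∧ ∀ t, |deriv (deriv ψ) t| ≤ A := by
  have h1 : ContDiff ℝ 1 (deriv ψ) := hψ.deriv'
  have h2 : ContDiff ℝ 0 (deriv (deriv ψ)) := h1.deriv'
  obtain ⟨A, hA⟩ := hψ.continuous.bounded_above_of_compact_support hc
  obtain ⟨B, hB⟩ := h2.continuous.bounded_above_of_compact_support hc.deriv.deriv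
  refine ⟨max A B, ?_, fun t => (hA t).trans (le_max_left _ _),
    fun t => (hB t).trans (le_max_right _ _)⟩
  exact (norm_nonneg _).trans ((hA 0).trans (le_max_left _ _))

/-- The mean value inequality is used twice: for `deriv ψ`, then for `s ↦ ψ (s + h) - ψ s`. -/
lemma abs_second_difference_le {ψ : ℝ → ℝ} (hψ : ContDiff ℝ 2 ψ) {A : ℝ}
    (hA : ∀ t, |deriv (deriv ψ) t| ≤ A) {h : ℝ} (hh : 0 ≤ h) (a : ℝ) :
    |ψ (a + h + h) - 2 * ψ (a + h) + ψ a| ≤ A * h ^ 2 := by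
  have d0 : Differentiable ℝ ψ := hψ.differentiable (by norm_num)
  have d1 : Differentiable ℝ (deriv ψ) := (hψ.deriv' : ContDiff ℝ 1 _).differentiable (by norm_num)
  have key : ∀ t, |deriv ψ (t + h) - deriv ψ t| ≤ A * h := fun t => by
    have := Convex.norm_image_sub_le_of_norm_deriv_le (f := deriv ψ) (s := univ) (x := t)
      (y := t + h) (C := A) (fun x _ => d1 x) (fun x _ => hA x) convex_univ (mem_univ _) (mem_univ _)
    simpa [abs_of_nonneg hh] using this
  have d2 : ∀ t, HasDerivAt (fun s => ψ (s + h) - ψ s) (deriv ψ (t + h) - deriv ψ t) t := fun t =>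
    ((d0 (t + h)).hasDerivAt.comp_add_const t h).sub (d0 t).hasDerivAt
  have := Convex.norm_image_sub_le_of_norm_hasDerivWithin_le (f := fun s => ψ (s + h) - ψ s)
    (s := univ) (x := a) (y := a + h) (C := A * h) (fun x _ => (d2 x).hasDerivWithinAt)
    (fun x _ => key x) convex_univ (mem_univ _) (mem_univ _)
  simp only [Real.norm_eq_abs, add_sub_cancel_left, abs_of_nonneg hh] at this
  calc _ = |ψ (a + h + h) - ψ (a + h) - (ψ (a + h) - ψ a)| := by ring_nf
    _ ≤ _ := this
    _ = _ := by ring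

/-- Two summations by parts. Indexing `c` by `ℤ` gives a meaning to `k - 2` at `k = 0, 1`; the four
vanishing values remove the boundary terms. -/
lemma sub_one_sq_mul_sum (c : ℤ → ℂ) (L : ℕ) (h1 : c (-1) = 0) (h2 : c (-2) = 0)
    (h3 : c L = 0) (h4 : c (L + 1) = 0) (z : ℂ) :
    (z - 1) ^ 2 * ∑ k ∈ Finset.range L, c k * z ^ k =
      ∑ k ∈ Finset.range (L + 2), (c k - 2 * c (k - 1) + c (k - 2)) * z ^ k := by
  have e0 : ∑ k ∈ Finset.range (L + 2), c k * z ^ k = ∑ k ∈ Finset.range L, c k * z ^ k := by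
    rw [Finset.sum_range_succ, Finset.sum_range_succ]; simp [h3, h4]
  have e1 : ∑ k ∈ Finset.range (L + 2), c (k - 1) * z ^ k =
      z * ∑ k ∈ Finset.range L, c k * z ^ k := by
    rw [Finset.sum_range_succ', Finset.sum_range_succ, Finset.mul_sum]
    have : ((L : ℤ) + 1 - 1) = L := by ring
    simp only [Nat.cast_add, Nat.cast_one, this, h3, Nat.cast_zero, zero_sub, h1]
    simp only [zero_mul, add_zero, add_sub_cancel_right, pow_succ]
    exact Finset.sum_congr rfl fun k _ => by ring
  have e2 : ∑ k ∈ Finset.range (L + 2), c (k - 2) * z ^ k =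
      z ^ 2 * ∑ k ∈ Finset.range L, c k * z ^ k := by
    rw [Finset.sum_range_succ', Finset.sum_range_succ', Finset.mul_sum]
    have h5 : ((0 + 1 : ℕ) : ℤ) - 2 = -1 := by norm_num
    have h6 : ((0 : ℕ) : ℤ) - 2 = -2 := by norm_num
    rw [h5, h6, h1, h2]
    simp only [zero_mul, add_zero]
    refine Finset.sum_congr rfl fun k _ => ?_
    have : (((k + 1 + 1 : ℕ) : ℤ) - 2) = k := by push_cast; ring
    rw [this]; ring
  calc _ = ∑ k ∈ Finset.range L, c k * z ^ k - 2 * (z * ∑ k ∈ Finset.range L, c k * z ^ k)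
        + z ^ 2 * ∑ k ∈ Finset.range L, c k * z ^ k := by ring
    _ = _ := by
      rw [← e1, ← e2, ← e0, Finset.mul_sum, ← Finset.sum_sub_distrib, ← Finset.sum_add_distrib]
      exact Finset.sum_congr rfl fun k _ => by ring

/-- The trigonometric polynomial `∑_{k < L} ψ(k / N) e^{ikθ}`. -/
noncomputable def dilatedKernel (ψ : ℝ → ℝ) (N L : ℕ) (θ : ℝ) : ℂ :=
  ∑ k ∈ Finset.range L, (ψ ((k : ℝ) / N) : ℂ) * Complex.exp (Complex.I * θ) ^ k

lemma continuous_dilatedKernel (ψ : ℝ → ℝ) (N L : ℕ) : Continuous (dilatedKernel ψ N L) := by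
  unfold dilatedKernel; fun_prop

lemma norm_exp_I_mul_ofReal (θ : ℝ) : ‖Complex.exp (Complex.I * θ)‖ = 1 := by
  rw [mul_comm]; exact Complex.norm_exp_ofReal_mul_I θ

/-- `|e^{iθ} - 1| = 2 |sin (θ/2)| ≥ |θ| / 2`, by Jordan's inequality and `π ≤ 4`. -/
lemma sq_le_norm_exp_sub_one_sq {θ : ℝ} (h : |θ| ≤ Real.pi) :
    θ ^ 2 ≤ 4 * ‖Complex.exp (Complex.I * θ) - 1‖ ^ 2 := by
  rw [Complex.norm_exp_I_mul_ofReal_sub_one, Real.norm_eq_abs, sq_abs]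
  have h1 : 2 / Real.pi * (|θ| / 2) ≤ Real.sin (|θ| / 2) :=
    Real.mul_le_sin (by positivity) (by linarith)
  have h2 : Real.sin (|θ| / 2) ^ 2 = Real.sin (θ / 2) ^ 2 := by
    rcases abs_cases θ with ⟨h, _⟩ | ⟨h, _⟩ <;> rw [h]
    rw [neg_div, Real.sin_neg]; ring
  have h3 : 1 / 4 * |θ| ≤ 2 / Real.pi * (|θ| / 2) := by
    have : (1 : ℝ) / 4 ≤ 1 / Real.pi := one_div_le_one_div_of_le Real.pi_pos Real.pi_le_four
    calc 1 / 4 * |θ| ≤ 1 / Real.pi * |θ| := by gcongr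
      _ = _ := by ring
  have h4 : (1 / 4 * |θ|) ^ 2 ≤ Real.sin (|θ| / 2) ^ 2 := by gcongr; linarith
  rw [h2, mul_pow, sq_abs] at h4
  nlinarith

/-- Dilations of a fixed `C²` profile give kernels with uniformly bounded `L¹` norms. -/
theorem exists_integral_dilatedKernel_le {ψ : ℝ → ℝ} (hψ : ContDiff ℝ 2 ψ) (R : ℕ)
    (h0 : ∀ t ≤ 0, ψ t = 0) (hR : ∀ t, (R : ℝ) ≤ t → ψ t = 0) :
    ∃ C : ℝ, 0 < C ∧ ∀ N : ℕ, 0 < N →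
      ∫ θ in (-Real.pi)..Real.pi, ‖dilatedKernel ψ N (R * N) θ‖ ≤ C := by
  have hcs : HasCompactSupport ψ := by
    refine HasCompactSupport.intro (isCompact_Icc (a := (0 : ℝ)) (b := R)) fun t ht => ?_
    rw [mem_Icc, not_and_or, not_le, not_le] at ht
    rcases ht with h | h
    · exact h0 t h.le
    · exact hR t h.le
  obtain ⟨A, hA0, hA1, hA2⟩ := exists_bound_deriv_two hψ hcs
  -- The first term comes from the trivial bound `b1`, the second from `b2`, whose factor `4` is
  -- that of `sq_le_norm_exp_sub_one_sq`.
  set M : ℝ := A * R + 4 * (A * (R + 2)) with hM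
  have hM0 : 0 ≤ M := by positivity
  refine ⟨2 * M * Real.pi + 1, by positivity, fun N hN => ?_⟩
  have hN' : (1 : ℝ) ≤ N := by exact_mod_cast hN
  have hN0 : (0 : ℝ) < N := by linarith
  have b1 : ∀ θ, ‖dilatedKernel ψ N (R * N) θ‖ ≤ A * R * N := fun θ => by
    calc _ ≤ ∑ k ∈ Finset.range (R * N),
          ‖(ψ ((k : ℝ) / N) : ℂ) * Complex.exp (Complex.I * θ) ^ k‖ := norm_sum_le _ _
      _ ≤ ∑ k ∈ Finset.range (R * N), A := Finset.sum_le_sum fun k _ => by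
          rw [norm_mul, norm_pow, norm_exp_I_mul_ofReal, one_pow, mul_one, Complex.norm_real]
          exact hA1 _
      _ = _ := by simp; ring
  -- There are `R * N + 2` second differences, each at most `A / N²`.
  have b2 : ∀ θ, ‖dilatedKernel ψ N (R * N) θ‖ * ‖Complex.exp (Complex.I * θ) - 1‖ ^ 2 ≤
      A * (R + 2) / N := fun θ => by
    have e := sub_one_sq_mul_sum (fun k : ℤ => (ψ ((k : ℝ) / N) : ℂ)) (R * N)
      (by rw [h0]; · simp
          · push_cast; exact div_nonpos_of_nonpos_of_nonneg (by norm_num) hN0.le)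
      (by rw [h0]; · simp
          · push_cast; exact div_nonpos_of_nonpos_of_nonneg (by norm_num) hN0.le)
      (by rw [hR]; · simp
          · push_cast; rw [le_div_iff₀ hN0])
      (by rw [hR]; · simp
          · push_cast; rw [le_div_iff₀ hN0]; linarith) (Complex.exp (Complex.I * θ))
    have e' : (Complex.exp (Complex.I * θ) - 1) ^ 2 * dilatedKernel ψ N (R * N) θ = _ := e
    rw [mul_comm, ← norm_pow, ← norm_mul, e']
    calc _ ≤ ∑ k ∈ Finset.range (R * N + 2), A * (1 / N : ℝ) ^ 2 := by
          refine norm_sum_le_of_le _ fun k _ => ?_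
          rw [norm_mul, norm_pow, norm_exp_I_mul_ofReal, one_pow, mul_one]
          have := abs_second_difference_le hψ hA2 (h := 1 / (N : ℝ)) (by positivity)
            (((k : ℤ) - 2 : ℤ) / N)
          convert this using 1
          rw [← Real.norm_eq_abs, ← Complex.norm_real]
          push_cast
          congr 1
          have a1 : ((k : ℝ) - 2) / N + 1 / N = (k - 1) / N := by ring
          have a2 : ((k : ℝ) - 1) / N + 1 / N = k / N := by ring
          rw [a1, a2]
      _ = A * (R * N + 2) / N ^ 2 := by simp; ring
      _ ≤ A * ((R + 2) * N) / N ^ 2 := by gcongr; nlinarith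
      _ = _ := by field_simp
  -- Adding `b1` to `N²` times the decay bound gives a majorant that is a dilate of `1 / (1 + x²)`;
  -- its integral is at most `M π` for every `N`.
  have b3 : ∀ θ ∈ Icc (-Real.pi) Real.pi, ‖dilatedKernel ψ N (R * N) θ‖ ≤
      M * N * (1 + (N * θ) ^ 2)⁻¹ := fun θ hθ => by
    rw [← div_eq_mul_inv, le_div_iff₀ (by positivity)]
    have h1 := sq_le_norm_exp_sub_one_sq (abs_le.2 hθ)
    have h2 := b2 θ
    have h3 := b1 θ
    have h4 : ‖dilatedKernel ψ N (R * N) θ‖ * θ ^ 2 ≤ 4 * (A * (R + 2) / N) := by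
      calc _ ≤ ‖dilatedKernel ψ N (R * N) θ‖ * (4 * ‖Complex.exp (Complex.I * θ) - 1‖ ^ 2) := by
            gcongr
        _ = 4 * (‖dilatedKernel ψ N (R * N) θ‖ * ‖Complex.exp (Complex.I * θ) - 1‖ ^ 2) := by ring
        _ ≤ _ := by gcongr
    calc _ = ‖dilatedKernel ψ N (R * N) θ‖ +
          N ^ 2 * (‖dilatedKernel ψ N (R * N) θ‖ * θ ^ 2) := by ring
      _ ≤ A * R * N + N ^ 2 * (4 * (A * (R + 2) / N)) := by gcongr
      _ = _ := by rw [hM]; field_simp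
  have c1 : Continuous fun θ : ℝ => M * N * (1 + (N * θ) ^ 2)⁻¹ := by
    refine continuous_const.mul (Continuous.inv₀ (by fun_prop) fun θ => by positivity)
  calc _ ≤ ∫ θ in (-Real.pi)..Real.pi, M * N * (1 + (N * θ) ^ 2)⁻¹ := by
        refine intervalIntegral.integral_mono_on (by linarith [Real.pi_pos])
          ((continuous_dilatedKernel _ _ _).norm.intervalIntegrable _ _)
          (c1.intervalIntegrable _ _) b3
    _ = M * (Real.arctan (N * Real.pi) - Real.arctan (N * -Real.pi)) := by
        rw [intervalIntegral.integral_const_mul,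
          intervalIntegral.integral_comp_mul_left (fun x => (1 + x ^ 2)⁻¹) hN0.ne',
          integral_inv_one_add_sq, smul_eq_mul]
        field_simp
    _ ≤ M * (Real.pi / 2 - -(Real.pi / 2)) := by
        gcongr
        · exact (Real.arctan_lt_pi_div_two _).le
        · exact (Real.neg_pi_div_two_lt_arctan _).le
    _ ≤ _ := by nlinarith [Real.pi_pos]

end Kernels

/-! ### Vector-valued power series: Cauchy's formula, multipliers, maximum principle. -/

section PowerSeries

variable {E : Type*} [NormedAddCommGroup E] [NormedSpace ℂ E]

/-- The sum of the `E`-valued power series with coefficients `x`. -/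
noncomputable def powerSum (x : ℕ → E) (w : ℂ) : E := ∑' k : ℕ, w ^ k • x k

lemma integral_exp_pow_mul_exp_neg_pow (j k : ℕ) :
    ∫ θ in (-Real.pi)..Real.pi,
      Complex.exp (Complex.I * θ) ^ j * Complex.exp (-(Complex.I * θ)) ^ k =
      if k = j then ((2 * Real.pi : ℝ) : ℂ) else 0 := by
  have e : ∀ θ : ℝ, Complex.exp (Complex.I * θ) ^ j * Complex.exp (-(Complex.I * θ)) ^ k =
      Complex.exp ((Complex.I * ((j : ℂ) - k)) * θ) := fun θ => by
    rw [← Complex.exp_nat_mul, ← Complex.exp_nat_mul, ← Complex.exp_add]; ring_nf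
  simp_rw [e]
  split_ifs with h
  · subst h; simp; ring
  · have hc : Complex.I * ((j : ℂ) - k) ≠ 0 := by
      refine mul_ne_zero Complex.I_ne_zero (sub_ne_zero.2 fun h' => h ?_)
      exact_mod_cast h'.symm
    rw [integral_exp_mul_complex hc, div_eq_zero_iff]
    left
    rw [sub_eq_zero, Complex.exp_eq_exp_iff_exists_int]
    exact ⟨(j : ℤ) - k, by push_cast; ring⟩

lemma summable_powerSum [CompleteSpace E] {h : ℕ → E} {ρ : ℝ}
    (hs : Summable fun k => ‖h k‖ * ρ ^ k) {w : ℂ} (hw : ‖w‖ = ρ) :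
    Summable fun k => w ^ k • h k := by
  refine Summable.of_norm (hs.congr fun k => ?_)
  rw [norm_smul, norm_pow, hw, mul_comm]

/-- Cauchy's formula for the coefficients. -/
lemma integral_exp_smul_powerSum [CompleteSpace E] {h : ℕ → E} {ρ : ℝ}
    (hs : Summable fun k => ‖h k‖ * ρ ^ k) {w : ℂ} (hw : ‖w‖ = ρ) (j : ℕ) :
    ∫ θ in (-Real.pi)..Real.pi,
      Complex.exp (Complex.I * θ) ^ j • powerSum h (Complex.exp (-(Complex.I * θ)) * w) =
      ((2 * Real.pi : ℝ) : ℂ) • w ^ j • h j := by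
  have hn : ∀ θ : ℝ, ‖Complex.exp (-(Complex.I * θ))‖ = 1 := fun θ => by
    rw [Complex.exp_neg, norm_inv, norm_exp_I_mul_ofReal, inv_one]
  have key := intervalIntegral.hasSum_integral_of_dominated_convergence
    (a := -Real.pi) (b := Real.pi) (μ := MeasureTheory.volume)
    (F := fun (k : ℕ) (θ : ℝ) => Complex.exp (Complex.I * θ) ^ j •
      (Complex.exp (-(Complex.I * θ)) * w) ^ k • h k)
    (f := fun θ => Complex.exp (Complex.I * θ) ^ j •
      powerSum h (Complex.exp (-(Complex.I * θ)) * w))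
    (fun k _ => ‖h k‖ * ρ ^ k)
    (fun k => by
      refine Continuous.aestronglyMeasurable ?_
      exact Continuous.smul (by fun_prop) (Continuous.smul (by fun_prop) continuous_const))
    (fun k => Eventually.of_forall fun θ _ => by
      rw [norm_smul, norm_smul, norm_pow, norm_pow, norm_mul, hn, norm_exp_I_mul_ofReal, hw]
      simp [mul_comm])
    (Eventually.of_forall fun θ _ => hs)
    (by simp)
    (Eventually.of_forall fun θ _ => by
      refine HasSum.const_smul _ (summable_powerSum hs ?_).hasSum
      rw [norm_mul, hn, hw, one_mul])
  have e : ∀ k, ∫ θ in (-Real.pi)..Real.pi, Complex.exp (Complex.I * θ) ^ j •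
      (Complex.exp (-(Complex.I * θ)) * w) ^ k • h k =
      if k = j then ((2 * Real.pi : ℝ) : ℂ) • w ^ j • h j else 0 := fun k => by
    have : ∀ θ : ℝ, Complex.exp (Complex.I * θ) ^ j •
      (Complex.exp (-(Complex.I * θ)) * w) ^ k • h k =
      (Complex.exp (Complex.I * θ) ^ j * Complex.exp (-(Complex.I * θ)) ^ k) • w ^ k • h k :=
      fun θ => by rw [mul_pow, mul_smul, mul_smul]
    simp_rw [this]
    rw [intervalIntegral.integral_smul_const, integral_exp_pow_mul_exp_neg_pow]
    split_ifs with hk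
    · rw [hk]
    · simp
  simp_rw [e] at key
  exact key.unique (hasSum_ite_eq j _)

lemma continuous_powerSum_circle [CompleteSpace E] {h : ℕ → E} {ρ : ℝ}
    (hs : Summable fun k => ‖h k‖ * ρ ^ k) {w : ℂ} (hw : ‖w‖ = ρ) :
    Continuous fun θ : ℝ => powerSum h (Complex.exp (-(Complex.I * θ)) * w) := by
  refine continuous_tsum (fun k => Continuous.smul (by fun_prop) continuous_const) hs ?_
  intro k θ
  rw [norm_smul, norm_pow, norm_mul, Complex.exp_neg, norm_inv, norm_exp_I_mul_ofReal, hw]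
  simp [mul_comm]

/-- A multiplier is bounded by the `L¹` norm of its kernel. -/
theorem norm_multiplier_le [CompleteSpace E] {h : ℕ → E} {ρ : ℝ}
    (hs : Summable fun k => ‖h k‖ * ρ ^ k) {B : ℝ} (hB : ∀ w, ‖w‖ = ρ → ‖powerSum h w‖ ≤ B)
    (c : ℕ → ℂ) (L : ℕ) {w : ℂ} (hw : ‖w‖ = ρ) :
    ‖∑ j ∈ Finset.range L, c j • w ^ j • h j‖ ≤ (2 * Real.pi)⁻¹ *
      (∫ θ in (-Real.pi)..Real.pi,
        ‖∑ j ∈ Finset.range L, c j * Complex.exp (Complex.I * θ) ^ j‖) * B := by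
  have hn : ∀ θ : ℝ, ‖Complex.exp (-(Complex.I * θ))‖ = 1 := fun θ => by
    rw [Complex.exp_neg, norm_inv, norm_exp_I_mul_ofReal, inv_one]
  have hcont := continuous_powerSum_circle hs hw
  -- Up to the factor `2π`, the multiplier is convolution with its kernel along the circle `‖w‖ =
  -- ρ`.
  have e : ∫ θ in (-Real.pi)..Real.pi,
      (∑ j ∈ Finset.range L, c j * Complex.exp (Complex.I * θ) ^ j) •
        powerSum h (Complex.exp (-(Complex.I * θ)) * w) =
      ((2 * Real.pi : ℝ) : ℂ) • ∑ j ∈ Finset.range L, c j • w ^ j • h j := by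
    simp_rw [Finset.sum_smul, mul_smul]
    rw [intervalIntegral.integral_finsetSum, Finset.smul_sum]
    · refine Finset.sum_congr rfl fun j _ => ?_
      rw [intervalIntegral.integral_smul, integral_exp_smul_powerSum hs hw, smul_comm]
    · intro j _
      refine Continuous.intervalIntegrable ?_ _ _
      exact Continuous.const_smul (Continuous.smul (by fun_prop) hcont) _
  have e2 : ‖((2 * Real.pi : ℝ) : ℂ) • ∑ j ∈ Finset.range L, c j • w ^ j • h j‖ ≤
      (∫ θ in (-Real.pi)..Real.pi,
        ‖∑ j ∈ Finset.range L, c j * Complex.exp (Complex.I * θ) ^ j‖) * B := by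
    rw [← e, ← intervalIntegral.integral_mul_const]
    have hpi : -Real.pi ≤ Real.pi := by linarith [Real.pi_pos]
    have hk : Continuous fun θ : ℝ =>
      ∑ j ∈ Finset.range L, c j * Complex.exp (Complex.I * θ) ^ j := by fun_prop
    refine (intervalIntegral.norm_integral_le_integral_norm hpi).trans
      (intervalIntegral.integral_mono_on hpi ?_ ?_ ?_)
    · exact (hk.smul hcont).norm.intervalIntegrable _ _
    · exact (hk.norm.mul continuous_const).intervalIntegrable _ _
    · intro θ _
      rw [norm_smul]
      gcongr
      exact hB _ (by rw [norm_mul, hn, hw, one_mul])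
  rw [norm_smul, Complex.norm_real, Real.norm_of_nonneg (by positivity)] at e2
  rw [mul_assoc, inv_mul_eq_div, le_div_iff₀ (by positivity), mul_comm]
  exact e2

/-- Cauchy's estimate. -/
lemma norm_coeff_le [CompleteSpace E] {h : ℕ → E} {ρ : ℝ}
    (hs : Summable fun k => ‖h k‖ * ρ ^ k) (hρ : 0 ≤ ρ) {B : ℝ}
    (hB : ∀ w, ‖w‖ = ρ → ‖powerSum h w‖ ≤ B) (j : ℕ) : ρ ^ j * ‖h j‖ ≤ B := by
  -- The kernel of this multiplier is `e^{ijθ}`, whose `L¹` norm is `2π`.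
  have := norm_multiplier_le hs hB (fun i => if i = j then 1 else 0) (j + 1) (w := ρ)
    (by simp [abs_of_nonneg hρ])
  simp only [ite_smul, one_smul, zero_smul, ite_mul, one_mul, zero_mul] at this
  simp [norm_smul, abs_of_nonneg hρ] at this
  convert this using 1
  have := Real.pi_pos
  field_simp
  ring

/-- Power series satisfy the maximum principle. -/
lemma norm_powerSum_le_of_sphere [CompleteSpace E] {h : ℕ → E} {ρ : ℝ} (hρ : 0 < ρ)
    (hs : Summable fun k => ‖h k‖ * ρ ^ k) {B : ℝ}
    (hB : ∀ w, ‖w‖ = ρ → ‖powerSum h w‖ ≤ B) {z : ℂ} (hz : ‖z‖ ≤ ρ) :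
    ‖powerSum h z‖ ≤ B := by
  have hb : ∀ k, ∀ w ∈ Metric.closedBall (0 : ℂ) ρ, ‖w ^ k • h k‖ ≤ ‖h k‖ * ρ ^ k := by
    intro k w hw
    rw [norm_smul, norm_pow, mul_comm]
    gcongr
    simpa using hw
  have d : DiffContOnCl ℂ (powerSum h) (Metric.ball 0 ρ) := by
    constructor
    · refine Complex.differentiableOn_tsum_of_summable_norm hs (fun k => ?_) Metric.isOpen_ball
        fun k w hw => hb k w (Metric.ball_subset_closedBall hw)
      exact Differentiable.differentiableOn (by fun_prop)
    · rw [closure_ball _ hρ.ne']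
      exact continuousOn_tsum (fun k => Continuous.continuousOn (by fun_prop)) hs
        fun k w hw => hb k w hw
  refine Complex.norm_le_of_forall_mem_frontier_norm_le Metric.isBounded_ball d (C := B) ?_ ?_
  · intro w hw
    rw [frontier_ball _ hρ.ne'] at hw
    exact hB w (by simpa using hw)
  · rw [closure_ball _ hρ.ne']
    simpa using hz

end PowerSeries

/-! ### The blocks `V_n * F` and their comparison with `z F'`. -/

section Blocks

/-- The Taylor coefficients of `V_n`. -/
noncomputable def vcoef (ω : ℝ → ℝ) : ℕ → ℕ → ℝ
  | 0, k => if k < 2 then 1 else 0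
  | n + 1, k => phi ω ((k : ℝ) / 2 ^ n)

section Cutoff

variable {ω : ℝ → ℝ} (hω : IsCutoff ω)
include hω

lemma IsCutoff.phi_eq_zero_of_le {t : ℝ} (ht : t ≤ 1) : phi ω t = 0 := by
  rw [phi, hω.eq_one t ht, hω.eq_one (t / 2) (by linarith), sub_self]

lemma IsCutoff.phi_eq_zero_of_ge {t : ℝ} (ht : 4 ≤ t) : phi ω t = 0 := by
  rw [phi, hω.eq_zero t (by linarith), hω.eq_zero (t / 2) (by linarith), sub_self]

lemma IsCutoff.contDiff (m : ℕ) : ContDiff ℝ m ω := hω.smooth.of_le (by exact_mod_cast le_top)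

lemma IsCutoff.contDiff_phi (m : ℕ) : ContDiff ℝ m (phi ω) := by
  have := hω.contDiff m
  unfold phi
  fun_prop

lemma IsCutoff.exists_bound : ∃ A : ℝ, 0 ≤ A ∧ ∀ t, |ω t| ≤ A := by
  obtain ⟨A, hA⟩ := (isCompact_Icc (a := (1 : ℝ)) (b := 2)).exists_bound_of_continuousOn
    hω.smooth.continuous.continuousOn
  refine ⟨max A 1, by positivity, fun t => ?_⟩
  rcases le_total t 1 with h | h
  · rw [hω.eq_one t h]; simp
  rcases le_total 2 t with h' | h'
  · rw [hω.eq_zero t h']; simp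
  · exact (hA t ⟨h, h'⟩).trans (le_max_left _ _)

lemma IsCutoff.vcoef_succ_eq_zero_of_le {n k : ℕ} (hk : k ≤ 2 ^ n) : vcoef ω (n + 1) k = 0 := by
  refine hω.phi_eq_zero_of_le ?_
  rw [div_le_one (by positivity)]
  exact_mod_cast hk

lemma IsCutoff.vcoef_eq_zero_of_ge {n k : ℕ} (hk : 2 ^ (n + 1) ≤ k) : vcoef ω n k = 0 := by
  cases n with
  | zero => simp only [vcoef]; rw [if_neg]; rw [zero_add, pow_one] at hk; omega
  | succ n =>
    refine hω.phi_eq_zero_of_ge ?_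
    rw [le_div_iff₀ (by positivity)]
    have : ((2 ^ (n + 1 + 1) : ℕ) : ℝ) ≤ k := by exact_mod_cast hk
    push_cast at this
    rw [pow_succ, pow_succ] at this
    linarith

/-- The telescoping identity behind `∑ V_n = 1 / (1 - z)`. -/
lemma IsCutoff.sum_vcoef (M k : ℕ) :
    ∑ n ∈ Finset.range (M + 1), vcoef ω n k = ω ((k : ℝ) / 2 ^ M) := by
  induction M with
  | zero =>
    simp only [zero_add, Finset.range_one, Finset.sum_singleton, vcoef, pow_zero, div_one]
    split_ifs with h
    · rw [hω.eq_one]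
      have : k ≤ 1 := by omega
      exact_mod_cast this
    · rw [hω.eq_zero]
      have : 2 ≤ k := by omega
      exact_mod_cast this
  | succ M ih =>
    rw [Finset.sum_range_succ, ih]
    simp only [vcoef, phi]
    rw [pow_succ, div_div]
    ring

/-- The profile of the multiplier recovering `V_n * f` from `z f'` on a smaller circle. -/
lemma IsCutoff.contDiff_phi_mul_exp_div :
    ContDiff ℝ 2 fun t => phi ω t * Real.exp t / t := by
  have h := hω.contDiff_phi 2
  rw [contDiff_iff_contDiffAt]
  intro t
  rcases lt_or_ge t 1 with ht | ht
  · refine (contDiffAt_const (c := (0 : ℝ))).congr_of_eventuallyEq ?_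
    filter_upwards [Iio_mem_nhds ht] with s hs
    rw [hω.phi_eq_zero_of_le (le_of_lt hs)]; simp
  · exact (h.contDiffAt.mul Real.contDiff_exp.contDiffAt).div contDiffAt_id (by simp; linarith)

end Cutoff

lemma summable_norm_mul_pow_of_eventually_zero {E : Type*} [NormedAddCommGroup E]
    {h : ℕ → E} {L : ℕ} (hL : ∀ k, L ≤ k → h k = 0)
    (ρ : ℝ) : Summable fun k => ‖h k‖ * ρ ^ k :=
  summable_of_ne_finset_zero (s := Finset.range L) fun k hk => by
    rw [hL k (by simpa using hk)]; simp

variable {E : Type*} [NormedAddCommGroup E] [NormedSpace ℂ E]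

/-- The block `V_n * F` of the power series with coefficients `x`. -/
noncomputable def block (ω : ℝ → ℝ) (x : ℕ → E) (n : ℕ) : ℂ → E :=
  powerSum fun k => (vcoef ω n k : ℂ) • x k

/-- The operator `F ↦ z F'` on coefficients. -/
noncomputable def eulerCoeff (x : ℕ → E) (k : ℕ) : E := (k : ℂ) • x k

lemma powerSum_eq_sum {h : ℕ → E} {L : ℕ} (hL : ∀ k, L ≤ k → h k = 0) (w : ℂ) :
    powerSum h w = ∑ k ∈ Finset.range L, w ^ k • h k :=
  tsum_eq_sum fun k hk => by rw [hL k (by simpa using hk), smul_zero]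

/-- A polynomial bounded on the open disk is bounded on the closed disk. -/
lemma norm_powerSum_le_of_disk {h : ℕ → E} {L : ℕ} (hL : ∀ k, L ≤ k → h k = 0) {B : ℝ}
    (hB : ∀ w ∈ disk, ‖powerSum h w‖ ≤ B) {w : ℂ} (hw : ‖w‖ ≤ 1) : ‖powerSum h w‖ ≤ B := by
  have hc : Continuous (powerSum h) := by
    have : powerSum h = _ := funext (powerSum_eq_sum hL)
    rw [this]; fun_prop
  have : closure disk ⊆ {w | ‖powerSum h w‖ ≤ B} :=
    closure_minimal hB (isClosed_le hc.norm continuous_const)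
  refine this ?_
  rw [disk, closure_ball _ one_ne_zero]
  simpa using hw

/-- `‖V_n * F‖` is controlled by `z F'` on the circle of radius `exp (-2^(1-n))`. -/
theorem exists_norm_block_succ_le {ω : ℝ → ℝ} (hω : IsCutoff ω) : ∃ C : ℝ, 0 < C ∧
    ∀ (E : Type) [NormedAddCommGroup E] [NormedSpace ℂ E] [CompleteSpace E] (x : ℕ → E)
      (n : ℕ) (B : ℝ),
      (Summable fun k => ‖eulerCoeff x k‖ * Real.exp (-(1 / 2 ^ n)) ^ k) →
      (∀ w, ‖w‖ = Real.exp (-(1 / 2 ^ n)) → ‖powerSum (eulerCoeff x) w‖ ≤ B) →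
      ∀ z, ‖z‖ ≤ 1 → ‖block ω x (n + 1) z‖ ≤ C * (1 / 2 ^ n) * B := by
  -- `phi ω` vanishes off `[1, 4]`, hence the value `4`.
  obtain ⟨C, hC, hker⟩ := exists_integral_dilatedKernel_le hω.contDiff_phi_mul_exp_div 4
    (fun t ht => by rw [hω.phi_eq_zero_of_le (by linarith)]; simp)
    (fun t ht => by rw [hω.phi_eq_zero_of_ge (by exact_mod_cast ht)]; simp)
  refine ⟨(2 * Real.pi)⁻¹ * C, by positivity, fun E _ _ _ x n B hs hB z hz => ?_⟩
  set N : ℕ := 2 ^ n with hN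
  have hNpos : 0 < N := by positivity
  have hNr : (2 : ℝ) ^ n = N := by rw [hN]; push_cast; rfl
  have hL : ∀ k, 4 * N ≤ k → (vcoef ω (n + 1) k : ℂ) • x k = 0 := fun k hk => by
    rw [hω.vcoef_eq_zero_of_ge (by rw [pow_succ, pow_succ]; omega)]; simp
  have hB0 : 0 ≤ B := (norm_nonneg _).trans (hB (Real.exp (-(1 / 2 ^ n)) : ℝ) (by
    rw [Complex.norm_real, Real.norm_of_nonneg (Real.exp_pos _).le]))
  refine norm_powerSum_le_of_sphere one_pos (summable_norm_mul_pow_of_eventually_zero hL _)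
    (fun z hz => ?_) hz
  have hw : ‖(Real.exp (-(1 / 2 ^ n)) : ℂ) * z‖ = Real.exp (-(1 / 2 ^ n)) := by
    rw [norm_mul, hz, mul_one, Complex.norm_real, Real.norm_of_nonneg (Real.exp_pos _).le]
  have key := norm_multiplier_le hs hB
    (fun k => ((phi ω ((k : ℝ) / N) * Real.exp ((k : ℝ) / N) / ((k : ℝ) / N) : ℝ) : ℂ)) (4 * N) hw
  -- With `t = k / N`, the factor `e^t` undoes the radius `e^{-1/N}`, and `1 / t = N / k` cancels
  -- the `k` of `z F'` and leaves the factor `N`.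
  have e : ∑ k ∈ Finset.range (4 * N),
      ((phi ω ((k : ℝ) / N) * Real.exp ((k : ℝ) / N) / ((k : ℝ) / N) : ℝ) : ℂ) •
        ((Real.exp (-(1 / 2 ^ n)) : ℂ) * z) ^ k • eulerCoeff x k =
      (N : ℂ) • powerSum (fun k => (vcoef ω (n + 1) k : ℂ) • x k) z := by
    rw [powerSum_eq_sum hL, Finset.smul_sum]
    refine Finset.sum_congr rfl fun k _ => ?_
    rw [eulerCoeff, smul_smul, smul_smul, smul_smul, smul_smul]
    congr 1
    simp only [vcoef, hNr]
    rcases Nat.eq_zero_or_pos k with rfl | hk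
    · rw [hω.phi_eq_zero_of_le (by simp)]; simp
    have h1 : (Real.exp ((k : ℝ) / N) : ℂ) * (Real.exp (-(1 / N)) : ℂ) ^ k = 1 := by
      rw [← Complex.ofReal_pow, ← Complex.ofReal_mul, ← Real.exp_nat_mul, ← Real.exp_add]
      have : (k : ℝ) / N + k * -(1 / N) = 0 := by ring
      rw [this]; simp
    have hk' : (k : ℂ) ≠ 0 := by exact_mod_cast hk.ne'
    have hN' : (N : ℂ) ≠ 0 := by exact_mod_cast hNpos.ne'
    rw [mul_pow]
    push_cast at h1 ⊢
    have : ∀ p a b : ℂ, p * a / ((k : ℂ) / N) * (b * z ^ k * k) = (a * b) * (N * p * z ^ k) := by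
      intro p a b; field_simp
    have h2 := this (phi ω ((k : ℝ) / N)) (Complex.exp ((k : ℂ) / N))
      (Complex.exp (-(1 / (N : ℂ))) ^ k)
    rw [h1, one_mul] at h2
    rw [mul_assoc, h2]
    ring
  rw [e, norm_smul, Complex.norm_natCast] at key
  have hk := hker N hNpos
  have key2 : N * ‖powerSum (fun k => (vcoef ω (n + 1) k : ℂ) • x k) z‖ ≤
      (2 * Real.pi)⁻¹ * C * B := by
    refine key.trans ?_
    gcongr
    exact hk
  rw [hNr]
  have hNr0 : (0 : ℝ) < N := by exact_mod_cast hNpos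
  calc _ = (1 / N) * (N * ‖powerSum (fun k => (vcoef ω (n + 1) k : ℂ) • x k) z‖) := by
        field_simp
    _ ≤ (1 / N) * ((2 * Real.pi)⁻¹ * C * B) := by gcongr
    _ = _ := by ring

/-- Cauchy's estimate for the polynomial `x 0 + x 1 w`. It gives Bernstein's inequality for `n = 0`
and controls `f' 0`, which `z f'` does not see at the origin. -/
lemma norm_coeff_one_le_of_block_zero {E : Type*} [NormedAddCommGroup E] [NormedSpace ℂ E]
    [CompleteSpace E] {ω : ℝ → ℝ} (hω : IsCutoff ω) (x : ℕ → E) {B : ℝ}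
    (hB : ∀ w ∈ disk, ‖block ω x 0 w‖ ≤ B) : ‖x 1‖ ≤ B := by
  have hL : ∀ k, 2 ≤ k → (vcoef ω 0 k : ℂ) • x k = 0 := fun k hk => by
    rw [hω.vcoef_eq_zero_of_ge (by simpa using hk)]; simp
  have := norm_coeff_le (summable_norm_mul_pow_of_eventually_zero hL 1) zero_le_one
    (fun w hw => norm_powerSum_le_of_disk hL hB hw.le) 1
  simpa [vcoef] using this

/-- Bernstein's inequality on the unit circle. The profile `t (ω (t/4) - ω (2t))` equals `t` on `[1,
4]`, which contains the support of `phi ω`, so `N` times it acts on the block as multiplication by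
`k`. It vanishes for `t ≥ 8`. -/
lemma norm_block_deriv_circle {ω : ℝ → ℝ} (hω : IsCutoff ω) : ∃ C : ℝ, 0 < C ∧
    ∀ (E : Type) [NormedAddCommGroup E] [NormedSpace ℂ E] [CompleteSpace E] (x : ℕ → E)
      (n : ℕ) (B : ℝ), (∀ w ∈ disk, ‖block ω x (n + 1) w‖ ≤ B) →
      ∀ z, ‖z‖ = 1 →
        ‖powerSum (eulerCoeff fun k => (vcoef ω (n + 1) k : ℂ) • x k) z‖ ≤ C * 2 ^ n * B := by
  have hcd : ContDiff ℝ 2 fun t => t * (ω (t / 4) - ω (2 * t)) := by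
    have := hω.contDiff 2
    fun_prop
  obtain ⟨C, hC, hker⟩ := exists_integral_dilatedKernel_le hcd 8
    (fun t ht => by rw [hω.eq_one _ (by linarith), hω.eq_one _ (by linarith)]; simp)
    (fun t ht => by
      push_cast at ht
      rw [hω.eq_zero _ (by linarith), hω.eq_zero _ (by linarith)]; simp)
  refine ⟨(2 * Real.pi)⁻¹ * C, by positivity, fun E _ _ _ x n B hB z hz => ?_⟩
  set N : ℕ := 2 ^ n with hN
  have hNpos : 0 < N := by positivity
  have hNr : (2 : ℝ) ^ n = N := by rw [hN]; push_cast; rfl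
  have hNr0 : (0 : ℝ) < N := by exact_mod_cast hNpos
  have hL4 : ∀ k, 4 * N ≤ k → vcoef ω (n + 1) k = 0 := fun k hk =>
    hω.vcoef_eq_zero_of_ge (by rw [pow_succ, pow_succ]; omega)
  have hL : ∀ k, 8 * N ≤ k → (vcoef ω (n + 1) k : ℂ) • x k = 0 := fun k hk => by
    rw [hL4 k (by omega)]; simp
  have hL' : ∀ k, 8 * N ≤ k → eulerCoeff (fun k => (vcoef ω (n + 1) k : ℂ) • x k) k = 0 :=
    fun k hk => by rw [eulerCoeff, hL k hk, smul_zero]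
  have hB0 : 0 ≤ B := (norm_nonneg _).trans (hB 0 (by simp [disk]))
  have key := norm_multiplier_le (summable_norm_mul_pow_of_eventually_zero hL 1)
    (fun w hw => norm_powerSum_le_of_disk hL hB hw.le)
    (fun k => (((k : ℝ) / N * (ω ((k : ℝ) / N / 4) - ω (2 * ((k : ℝ) / N))) : ℝ) : ℂ)) (8 * N) hz
  have e : powerSum (eulerCoeff fun k => (vcoef ω (n + 1) k : ℂ) • x k) z =
      (N : ℂ) • ∑ k ∈ Finset.range (8 * N),
        (((k : ℝ) / N * (ω ((k : ℝ) / N / 4) - ω (2 * ((k : ℝ) / N))) : ℝ) : ℂ) •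
          z ^ k • (vcoef ω (n + 1) k : ℂ) • x k := by
    rw [powerSum_eq_sum hL', Finset.smul_sum]
    refine Finset.sum_congr rfl fun k _ => ?_
    rw [eulerCoeff]
    rcases le_or_gt k N with hk | hk
    · rw [hω.vcoef_succ_eq_zero_of_le hk]; simp
    rcases le_or_gt (4 * N) k with hk4 | hk4
    · rw [hL4 k hk4]; simp
    have h1 : ω ((k : ℝ) / N / 4) = 1 := hω.eq_one _ (by
      rw [div_div, div_le_one (by positivity), mul_comm]; exact_mod_cast hk4.le)
    have h2 : ω (2 * ((k : ℝ) / N)) = 0 := hω.eq_zero _ (by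
      have : 1 ≤ (k : ℝ) / N := by rw [le_div_iff₀ hNr0, one_mul]; exact_mod_cast hk.le
      linarith)
    rw [h1, h2, sub_zero, mul_one, smul_smul, smul_smul, smul_smul, smul_smul, smul_smul]
    congr 1
    have hN' : (N : ℂ) ≠ 0 := by exact_mod_cast hNpos.ne'
    push_cast
    field_simp
  rw [e, norm_smul, Complex.norm_natCast, hNr]
  have hk := hker N hNpos
  calc _ ≤ (N : ℝ) * ((2 * Real.pi)⁻¹ * C * B) := by
        gcongr
        refine key.trans ?_
        gcongr
        exact hk
    _ = _ := by ring

lemma powerSum_eq_pow_smul {h : ℕ → E} {N : ℕ} (hN : ∀ k < N, h k = 0) {L : ℕ}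
    (hL : ∀ k, L ≤ k → h k = 0) (w : ℂ) :
    powerSum h w = w ^ N • powerSum (fun k => h (k + N)) w := by
  rw [powerSum_eq_sum (h := h) (L := N + L) (fun k hk => hL k (by omega)),
    powerSum_eq_sum (h := fun k => h (k + N)) (L := L) (fun k hk => hL _ (by omega)),
    Finset.sum_range_add, Finset.sum_eq_zero (fun k hk => ?_), zero_add, Finset.smul_sum]
  · exact Finset.sum_congr rfl fun k _ => by rw [smul_smul, pow_add, add_comm k N]
  · rw [hN k (by simpa using hk), smul_zero]

/-- Bernstein's inequality for the blocks, with decay inside the disk. -/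
theorem exists_norm_block_deriv_le {ω : ℝ → ℝ} (hω : IsCutoff ω) : ∃ C : ℝ, 0 < C ∧
    ∀ (E : Type) [NormedAddCommGroup E] [NormedSpace ℂ E] [CompleteSpace E] (x : ℕ → E)
      (n : ℕ) (B : ℝ), (∀ w ∈ disk, ‖block ω x n w‖ ≤ B) →
      ∀ z ∈ disk, ‖powerSum (eulerCoeff fun k => (vcoef ω n k : ℂ) • x k) z‖ ≤
        C * (‖z‖ * (2 ^ n * Real.exp (-(2 ^ n * (1 - ‖z‖) / 2)))) * B := by
  obtain ⟨C, hC, h⟩ := norm_block_deriv_circle hω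
  have he := Real.exp_pos 1
  -- The first summand serves the blocks `n + 1`, the second the block `0`.
  refine ⟨C * Real.exp 1 + Real.exp 1, by positivity, fun E _ _ _ x n B hB z hz => ?_⟩
  have hB0 : 0 ≤ B := (norm_nonneg _).trans (hB 0 (by simp [disk]))
  have hz1 : ‖z‖ < 1 := by simpa [disk] using hz
  cases n with
  | zero =>
    have hx := norm_coeff_one_le_of_block_zero hω x hB
    have hL' : ∀ k, 2 ≤ k → eulerCoeff (fun k => (vcoef ω 0 k : ℂ) • x k) k = 0 :=
      fun k hk => by rw [eulerCoeff, hω.vcoef_eq_zero_of_ge (by simpa using hk)]; simp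
    rw [powerSum_eq_sum hL']
    simp only [Finset.sum_range_succ, Finset.range_zero, Finset.sum_empty, eulerCoeff, vcoef]
    simp only [pow_zero, CharP.cast_eq_zero, Nat.ofNat_pos, ↓reduceIte, Complex.ofReal_one,
      one_smul, zero_smul, add_zero, pow_one, Nat.cast_one, Nat.one_lt_ofNat, zero_add, one_mul]
    rw [norm_smul]
    have h1 : 1 ≤ (C * Real.exp 1 + Real.exp 1) * Real.exp (-((1 - ‖z‖) / 2)) := by
      calc (1 : ℝ) ≤ Real.exp (1 + -((1 - ‖z‖) / 2)) :=
            Real.one_le_exp (by linarith [norm_nonneg z])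
        _ = Real.exp 1 * Real.exp (-((1 - ‖z‖) / 2)) := Real.exp_add _ _
        _ ≤ _ := by gcongr; nlinarith
    calc ‖z‖ * ‖x 1‖ ≤ 1 * (‖z‖ * B) := by rw [one_mul]; gcongr
      _ ≤ ((C * Real.exp 1 + Real.exp 1) * Real.exp (-((1 - ‖z‖) / 2))) * (‖z‖ * B) := by gcongr
      _ = _ := by ring
  | succ n =>
    have hN0 : ∀ k < 2 ^ n, eulerCoeff (fun k => (vcoef ω (n + 1) k : ℂ) • x k) k = 0 :=
      fun k hk => by rw [eulerCoeff, hω.vcoef_succ_eq_zero_of_le hk.le]; simp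
    have hL : ∀ k, 2 ^ (n + 1 + 1) ≤ k →
        eulerCoeff (fun k => (vcoef ω (n + 1) k : ℂ) • x k) k = 0 :=
      fun k hk => by rw [eulerCoeff, hω.vcoef_eq_zero_of_ge hk]; simp
    have hfac := powerSum_eq_pow_smul hN0 hL
    -- The maximum principle is applied after division by `z ^ 2 ^ n`; multiplying back yields the
    -- decay inside the disk.
    have hq : ‖powerSum (fun k => eulerCoeff (fun k => (vcoef ω (n + 1) k : ℂ) • x k)
        (k + 2 ^ n)) z‖ ≤ C * 2 ^ n * B := by
      refine norm_powerSum_le_of_sphere one_pos (summable_norm_mul_pow_of_eventually_zero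
        (L := 2 ^ (n + 1 + 1)) (fun k hk => hL _ (by omega)) _) (fun w hw => ?_) hz1.le
      have := h E x n B hB w hw
      rwa [hfac, norm_smul, norm_pow, hw, one_pow, one_mul] at this
    rw [hfac, norm_smul, norm_pow]
    -- One factor `‖z‖` is kept, to be cancelled against that of `z f'` later; giving it up in the
    -- exponent costs `e^{1 - ‖z‖} ≤ e`.
    have hp : ‖z‖ ^ (2 ^ n) ≤
        Real.exp 1 * (‖z‖ * Real.exp (-(2 ^ (n + 1) * (1 - ‖z‖) / 2))) := by
      obtain ⟨N, hN⟩ : ∃ N, 2 ^ n = N + 1 :=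
        Nat.exists_eq_succ_of_ne_zero (by positivity)
      have hN' : (2 : ℝ) ^ n = N + 1 := by exact_mod_cast hN
      have h1 : ‖z‖ ≤ Real.exp (-(1 - ‖z‖)) := by
        have := Real.add_one_le_exp (-(1 - ‖z‖)); linarith
      rw [hN, pow_succ]
      calc ‖z‖ ^ N * ‖z‖ ≤ Real.exp (-(1 - ‖z‖)) ^ N * ‖z‖ := by gcongr
        _ = Real.exp (-(N * (1 - ‖z‖))) * ‖z‖ := by rw [← Real.exp_nat_mul]; ring_nf
        _ ≤ Real.exp (1 + -(2 ^ (n + 1) * (1 - ‖z‖) / 2)) * ‖z‖ := by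
            gcongr
            rw [pow_succ, hN']
            nlinarith [norm_nonneg z]
        _ = _ := by rw [Real.exp_add]; ring
    calc _ ≤ Real.exp 1 * (‖z‖ * Real.exp (-(2 ^ (n + 1) * (1 - ‖z‖) / 2))) * (C * 2 ^ n * B) := by
          gcongr
      _ = (C * Real.exp 1) * (‖z‖ * (2 ^ n * Real.exp (-(2 ^ (n + 1) * (1 - ‖z‖) / 2)))) * B := by
          ring
      _ ≤ _ := by
          gcongr
          · linarith
          · norm_num
          · omega

/-- `z F' = ∑ z (V_n * F)'`. -/
theorem enorm_powerSum_eulerCoeff_le [CompleteSpace E] {ω : ℝ → ℝ} (hω : IsCutoff ω) (x : ℕ → E)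
    {z : ℂ} (hs : Summable fun k => ‖eulerCoeff x k‖ * ‖z‖ ^ k) :
    ‖powerSum (eulerCoeff x) z‖ₑ ≤
      ∑' n, ‖powerSum (eulerCoeff fun k => (vcoef ω n k : ℂ) • x k) z‖ₑ := by
  obtain ⟨A, hA0, hA⟩ := hω.exists_bound
  -- By telescoping, a partial sum of blocks is the multiplier `ω (k / 2^M)`, which is bounded by
  -- `A` and equals `1` once `k ≤ 2^M`.
  have hsum : ∀ M : ℕ, ∑ n ∈ Finset.range (M + 1),
      powerSum (eulerCoeff fun k => (vcoef ω n k : ℂ) • x k) z =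
      ∑' k : ℕ, (ω ((k : ℝ) / 2 ^ M) : ℂ) • z ^ k • eulerCoeff x k := fun M => by
    simp only [powerSum]
    rw [← Summable.tsum_finsetSum]
    · refine tsum_congr fun k => ?_
      rw [← hω.sum_vcoef, Complex.ofReal_sum, Finset.sum_smul]
      refine Finset.sum_congr rfl fun n _ => ?_
      simp only [eulerCoeff, smul_smul]
      congr 1; ring
    · intro n _
      refine summable_of_ne_finset_zero (s := Finset.range (2 ^ (n + 1))) fun k hk => ?_
      rw [eulerCoeff, hω.vcoef_eq_zero_of_ge (by simpa using hk)]; simp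
  have hlim : Tendsto (fun M : ℕ => ∑' k : ℕ, (ω ((k : ℝ) / 2 ^ M) : ℂ) • z ^ k • eulerCoeff x k)
      atTop
      (𝓝 (powerSum (eulerCoeff x) z)) := by
    refine tendsto_tsum_of_dominated_convergence (bound := fun k => A * (‖eulerCoeff x k‖ * ‖z‖ ^ k))
      (hs.mul_left A) (fun k => ?_) (Eventually.of_forall fun M k => ?_)
    · refine tendsto_const_nhds.congr' ?_
      filter_upwards [eventually_ge_atTop k] with M hM
      rw [hω.eq_one]
      · simp
      · rw [div_le_one (by positivity)]
        exact_mod_cast hM.trans (Nat.lt_two_pow_self).le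
    · rw [norm_smul, norm_smul, norm_pow, Complex.norm_real, mul_comm (‖z‖ ^ k)]
      gcongr
      exact hA _
  simp_rw [← hsum] at hlim
  refine le_of_tendsto (continuous_enorm.continuousAt.tendsto.comp hlim)
    (Eventually.of_forall fun M => ?_)
  exact (enorm_sum_le _ _).trans (ENNReal.sum_le_tsum _)

end Blocks

/-! ### Logarithmic weights on dyadic annuli and the convolution kernel. -/

section Weights

lemma rpow_le_of_comparable {a b Q s : ℝ} {p : ℕ} (ha : 0 < a) (hb : 0 < b) (hQ : 1 ≤ Q)
    (hab : a ≤ Q * b) (hba : b ≤ Q * a) (hs : |s| ≤ p) : a ^ s ≤ Q ^ p * b ^ s := by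
  have hQ0 : 0 < Q := by linarith
  have h1 : Q ^ |s| ≤ Q ^ p := by
    rw [← Real.rpow_natCast]; exact Real.rpow_le_rpow_of_exponent_le hQ hs
  rcases le_total 0 s with h | h
  · rw [abs_of_nonneg h] at h1
    calc a ^ s ≤ (Q * b) ^ s := Real.rpow_le_rpow ha.le hab h
      _ = Q ^ s * b ^ s := Real.mul_rpow hQ0.le hb.le
      _ ≤ _ := by gcongr
  · rw [abs_of_nonpos h] at h1
    calc a ^ s ≤ (b / Q) ^ s := Real.rpow_le_rpow_of_nonpos (by positivity)
          (by rwa [div_le_iff₀ hQ0, mul_comm]) h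
      _ = Q ^ (-s) * b ^ s := by
          rw [Real.div_rpow hb.le hQ0.le, Real.rpow_neg hQ0.le, div_eq_mul_inv, mul_comm]
      _ ≤ _ := by gcongr

/-- The logarithm lies between `(m + 1) log 2` and `(m + 3) log 2`. The slack `/ 4` lets the lemma
serve both dyadic annuli and the radii `exp (-2^(-n))`. -/
lemma log_two_div_bounds {r : ℝ} {m : ℕ} (h1 : (1 / 2 : ℝ) ^ m / 4 ≤ 1 - r)
    (h2 : 1 - r ≤ (1 / 2 : ℝ) ^ m) :
    Real.log (2 / (1 - r)) ≤ 4 * ((m : ℝ) + 1) ∧ (m : ℝ) + 2 ≤ 4 * Real.log (2 / (1 - r)) := by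
  have hpos : (0 : ℝ) < (1 / 2) ^ m := by positivity
  have hr : 0 < 1 - r := by linarith
  have l1 := Real.log_two_gt_d9
  have l2 := Real.log_two_lt_d9
  have hm : (0 : ℝ) ≤ m := m.cast_nonneg
  rw [Real.log_div two_ne_zero hr.ne']
  have e : Real.log ((1 / 2 : ℝ) ^ m) = -(m * Real.log 2) := by
    rw [Real.log_pow, one_div, Real.log_inv]; ring
  constructor
  · have := Real.log_le_log (by positivity) h1
    rw [Real.log_div hpos.ne' (by norm_num), e, show (4 : ℝ) = 2 ^ 2 by norm_num,
      Real.log_pow] at this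
    push_cast at this
    nlinarith
  · have := Real.log_le_log hr h2
    rw [e] at this
    nlinarith

/-- The range of `q` covers the weights `m + 1` and `m + 2` of the blocks `m` and `m + 1`. -/
lemma logWeight_comparable {s : ℝ} {p : ℕ} (hs : |s| ≤ p) {z : ℂ} {m : ℕ}
    (h1 : (1 / 2 : ℝ) ^ m / 4 ≤ 1 - ‖z‖) (h2 : 1 - ‖z‖ ≤ (1 / 2 : ℝ) ^ m) {q : ℝ}
    (hq1 : (m : ℝ) + 1 ≤ q) (hq2 : q ≤ m + 2) :
    logWeight s z ≤ 4 ^ p * q ^ s ∧ q ^ s ≤ 4 ^ p * logWeight s z := by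
  obtain ⟨h3, h4⟩ := log_two_div_bounds h1 h2
  have hm : (0 : ℝ) ≤ m := m.cast_nonneg
  have a : 0 < Real.log (2 / (1 - ‖z‖)) := by linarith
  exact ⟨rpow_le_of_comparable a (by linarith) (by norm_num) (by linarith) (by linarith) hs,
    rpow_le_of_comparable (by linarith) a (by norm_num) (by linarith) (by linarith) hs⟩

lemma exists_dyadic {r : ℝ} (h0 : 0 ≤ r) (h1 : r < 1) :
    ∃ m : ℕ, (1 / 2 : ℝ) ^ m / 2 ≤ 1 - r ∧ 1 - r ≤ (1 / 2 : ℝ) ^ m := by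
  obtain ⟨m, h2, h3⟩ := exists_nat_pow_near_of_lt_one (x := 1 - r) (y := 1 / 2) (by linarith)
    (by linarith) (by norm_num) (by norm_num)
  exact ⟨m, by rw [pow_succ] at h2; linarith, h3⟩

/-- The convolution kernel `2^{-|n-m|} (1 + |n-m|)^p`. -/
noncomputable def dyadicKernel (p n m : ℕ) : ℝ :=
  (1 / 2) ^ ((n : ℤ) - m).natAbs * (1 + (((n : ℤ) - m).natAbs : ℝ)) ^ p

lemma dyadicKernel_nonneg (p n m : ℕ) : 0 ≤ dyadicKernel p n m := by
  unfold dyadicKernel; positivity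

lemma dyadicKernel_comm (p n m : ℕ) : dyadicKernel p n m = dyadicKernel p m n := by
  unfold dyadicKernel; rw [← Int.natAbs_neg, neg_sub]

lemma summable_half_pow_mul (p : ℕ) :
    Summable fun d : ℕ => (1 / 2 : ℝ) ^ d * (1 + (d : ℝ)) ^ p := by
  have h := summable_pow_mul_geometric_of_norm_lt_one (R := ℝ) p (r := 1 / 2) (by norm_num)
  have h2 := ((summable_nat_add_iff 1).2 h).mul_left 2
  refine h2.congr fun d => ?_
  push_cast
  rw [pow_succ (1 / 2 : ℝ)]
  ring_nf

/-- Each sum is part of one convergent series over `ℤ`. The sums over `m` give the `ℓ¹` estimate,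
those over `n` the `ℓ^∞` and `c₀` estimates. -/
lemma exists_tsum_dyadicKernel_le (p : ℕ) : ∃ S : ℝ≥0,
    (∀ n, ∑' m, ENNReal.ofReal (dyadicKernel p n m) ≤ S) ∧
    ∀ m, ∑' n, ENNReal.ofReal (dyadicKernel p n m) ≤ S := by
  have h := summable_half_pow_mul p
  have hZ : Summable fun j : ℤ => (1 / 2 : ℝ) ^ j.natAbs * (1 + (j.natAbs : ℝ)) ^ p :=
    Summable.of_nat_of_neg (by simpa using h) (by simpa using h)
  have hfin : ∑' j : ℤ, ENNReal.ofReal ((1 / 2 : ℝ) ^ j.natAbs * (1 + (j.natAbs : ℝ)) ^ p) ≠ ∞ :=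
    hZ.tsum_ofReal_ne_top
  have hle : ∀ n, ∑' m, ENNReal.ofReal (dyadicKernel p n m) ≤
      ∑' j : ℤ, ENNReal.ofReal ((1 / 2 : ℝ) ^ j.natAbs * (1 + (j.natAbs : ℝ)) ^ p) := fun n =>
    ENNReal.tsum_comp_le_tsum_of_injective (f := fun m : ℕ => (n : ℤ) - m)
      (fun a b hab => by simpa using hab) _
  refine ⟨(∑' j : ℤ, ENNReal.ofReal ((1 / 2 : ℝ) ^ j.natAbs * (1 + (j.natAbs : ℝ)) ^ p)).toNNReal,
    ?_, ?_⟩ <;> rw [ENNReal.coe_toNNReal hfin]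
  · exact hle
  · intro m
    simp_rw [fun n => dyadicKernel_comm p n m]
    exact hle m

lemma tendsto_dyadicKernel (p n : ℕ) : Tendsto (dyadicKernel p n) atTop (𝓝 0) := by
  have h := (summable_half_pow_mul p).tendsto_atTop_zero
  rw [← tendsto_add_atTop_iff_nat n]
  refine h.congr fun d => ?_
  have : ((n : ℤ) - ((d + n : ℕ) : ℤ)).natAbs = d := by omega
  simp [dyadicKernel]

/-- The quadratic term of the exponential series gives `x² / 32 ≤ e^{x/4}`. -/
lemma mul_exp_neg_le {x : ℝ} (hx : 0 < x) : x * Real.exp (-(x / 4)) ≤ 32 * x⁻¹ := by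
  have h := Real.quadratic_le_exp_of_nonneg (x := x / 4) (by positivity)
  rw [Real.exp_neg, ← div_eq_mul_inv, ← div_eq_mul_inv,
    div_le_div_iff₀ (Real.exp_pos _) hx]
  nlinarith

/-- With `x = 2^(n-m)` the left side is at most `x e^{-x/4} ≤ 32 min(x, 1/x)`: the exponential
decays for `n ≥ m`, and the factor `x` is small for `n ≤ m`. -/
lemma two_pow_mul_exp_le {r : ℝ} {m n : ℕ} (h1 : (1 / 2 : ℝ) ^ m / 2 ≤ 1 - r)
    (h2 : 1 - r ≤ (1 / 2 : ℝ) ^ m) :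
    (1 - r) * (2 ^ n * Real.exp (-(2 ^ n * (1 - r) / 2))) ≤
      32 * (1 / 2) ^ ((n : ℤ) - m).natAbs := by
  have hx : (0 : ℝ) < 2 ^ n * (1 / 2) ^ m := by positivity
  have h3 : (1 - r) * (2 ^ n * Real.exp (-(2 ^ n * (1 - r) / 2))) ≤
      (2 ^ n * (1 / 2) ^ m) * Real.exp (-((2 ^ n * (1 / 2) ^ m) / 4)) := by
    calc _ ≤ (1 / 2 : ℝ) ^ m * (2 ^ n * Real.exp (-((2 ^ n * (1 / 2) ^ m) / 4))) := by
          have : Real.exp (-(2 ^ n * (1 - r) / 2)) ≤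
              Real.exp (-((2 ^ n * (1 / 2) ^ m) / 4)) := by
            apply Real.exp_le_exp.2
            have : (2 : ℝ) ^ n * ((1 / 2) ^ m / 2) ≤ 2 ^ n * (1 - r) := by gcongr
            linarith
          gcongr
      _ = _ := by ring
  refine h3.trans ?_
  rcases le_total m n with h | h
  · obtain ⟨d, rfl⟩ := Nat.exists_eq_add_of_le h
    have e1 : (((m + d : ℕ) : ℤ) - m).natAbs = d := by omega
    have e2 : (2 : ℝ) ^ (m + d) * (1 / 2) ^ m = 2 ^ d := by
      rw [pow_add, mul_right_comm, ← mul_pow]; norm_num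
    rw [e1, e2]
    refine (mul_exp_neg_le (by positivity)).trans (le_of_eq ?_)
    rw [one_div, inv_pow]
  · obtain ⟨d, rfl⟩ := Nat.exists_eq_add_of_le h
    have e1 : ((n : ℤ) - ((n + d : ℕ) : ℤ)).natAbs = d := by omega
    have e2 : (2 : ℝ) ^ n * (1 / 2) ^ (n + d) = (1 / 2) ^ d := by
      rw [pow_add, ← mul_assoc, ← mul_pow]; norm_num
    rw [e1, e2]
    have : Real.exp (-((1 / 2 : ℝ) ^ d / 4)) ≤ 1 := Real.exp_le_one_iff.2 (by
      have : (0 : ℝ) < (1 / 2) ^ d := by positivity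
      linarith)
    have hd : (0 : ℝ) < (1 / 2) ^ d := by positivity
    nlinarith

/-- Replacing `(m + 1)^s` by `(n + 1)^s` costs `(1 + |n - m|)^p`, since each of `m + 1`, `n + 1` is
at most `1 + |n - m|` times the other. The geometric decay absorbs this loss. -/
lemma weight_mul_le {s : ℝ} {p : ℕ} (hs : |s| ≤ p) {z : ℂ} {m : ℕ} (n : ℕ)
    (h1 : (1 / 2 : ℝ) ^ m / 2 ≤ 1 - ‖z‖) (h2 : 1 - ‖z‖ ≤ (1 / 2 : ℝ) ^ m) :
    (1 - ‖z‖) * logWeight s z * (2 ^ n * Real.exp (-(2 ^ n * (1 - ‖z‖) / 2))) ≤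
      (32 * 4 ^ p) * dyadicKernel p n m * ((n : ℝ) + 1) ^ s := by
  have hm : (0 : ℝ) < (1 / 2) ^ m := by positivity
  have a1 := two_pow_mul_exp_le (n := n) h1 h2
  have a2 := (logWeight_comparable hs (by linarith) h2 le_rfl (by linarith)).1
  have a3 : ((m : ℝ) + 1) ^ s ≤ (1 + (((n : ℤ) - m).natAbs : ℝ)) ^ p * ((n : ℝ) + 1) ^ s := by
    have e : ((((n : ℤ) - m).natAbs : ℕ) : ℝ) = |(n : ℝ) - m| := by
      rw [Nat.cast_natAbs]; push_cast; rfl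
    have hn0 : (0 : ℝ) ≤ n := n.cast_nonneg
    have hm0 : (0 : ℝ) ≤ m := m.cast_nonneg
    have b1 := le_abs_self ((n : ℝ) - m)
    have b2 := neg_abs_le ((n : ℝ) - m)
    have b3 := abs_nonneg ((n : ℝ) - m)
    refine rpow_le_of_comparable (by positivity) (by positivity) ?_ ?_ ?_ hs <;> rw [e] <;>
      nlinarith
  have hw : 0 ≤ logWeight s z := by
    refine Real.rpow_nonneg (Real.log_nonneg ?_) _
    rw [le_div_iff₀ (by linarith)]
    linarith [norm_nonneg z]
  calc _ = ((1 - ‖z‖) * (2 ^ n * Real.exp (-(2 ^ n * (1 - ‖z‖) / 2)))) * logWeight s z := by ring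
    _ ≤ (32 * (1 / 2) ^ ((n : ℤ) - m).natAbs) *
        (4 ^ p * ((1 + (((n : ℤ) - m).natAbs : ℝ)) ^ p * ((n : ℝ) + 1) ^ s)) := by
        gcongr
        exact a2.trans (by gcongr)
    _ = _ := by unfold dyadicKernel; ring

variable {E : Type*} [NormedAddCommGroup E] [NormedSpace ℂ E]

/-- The supremum norm over the disk. -/
noncomputable def diskNorm {E : Type*} [NormedAddCommGroup E] (F : ℂ → E) : ℝ≥0∞ :=
  ⨆ z ∈ disk, ‖F z‖ₑ

lemma diskNorm_le_iff {E : Type*} [NormedAddCommGroup E] {F : ℂ → E} {B : ℝ} (hB : 0 ≤ B) :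
    diskNorm F ≤ ENNReal.ofReal B ↔ ∀ z ∈ disk, ‖F z‖ ≤ B := by
  simp only [diskNorm, iSup_le_iff]
  refine forall₂_congr fun z _ => ?_
  rw [← ofReal_norm, ENNReal.ofReal_le_ofReal_iff hB]

lemma IsCutoff.diskNorm_block_ne_top {ω : ℝ → ℝ} (hω : IsCutoff ω) (x : ℕ → E) (n : ℕ) :
    diskNorm (block ω x n) ≠ ∞ := by
  refine ne_top_of_le_ne_top ENNReal.ofReal_ne_top
    ((diskNorm_le_iff (B := ∑ k ∈ Finset.range (2 ^ (n + 1)), ‖(vcoef ω n k : ℂ) • x k‖)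
      (by positivity)).2 fun z hz => ?_)
  rw [block, powerSum_eq_sum (L := 2 ^ (n + 1)) fun k hk => by
    rw [hω.vcoef_eq_zero_of_ge hk]; simp]
  refine norm_sum_le_of_le _ fun k _ => ?_
  rw [norm_smul, norm_pow]
  refine mul_le_of_le_one_left (norm_nonneg _) (pow_le_one₀ (norm_nonneg _) ?_)
  simpa [disk] using (mem_ball_zero_iff.1 hz).le

/-- The weighted block norm `(n + 1)^s ‖V_n * F‖`. -/
noncomputable def weightedBlock (ω : ℝ → ℝ) (s : ℝ) (x : ℕ → E) (n : ℕ) : ℝ≥0∞ :=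
  ENNReal.ofReal (((n : ℝ) + 1) ^ s) * diskNorm (block ω x n)

lemma logWeight_nonneg (s : ℝ) {z : ℂ} (hz : z ∈ disk) : 0 ≤ logWeight s z := by
  have hz' : ‖z‖ < 1 := mem_ball_zero_iff.1 hz
  refine Real.rpow_nonneg (Real.log_nonneg ?_) _
  rw [le_div_iff₀ (by linarith)]
  linarith [norm_nonneg z]

/-- The derivative is controlled by the blocks. -/
theorem exists_weight_mul_enorm_le {ω : ℝ → ℝ} (hω : IsCutoff ω) {s : ℝ} {p : ℕ} (hs : |s| ≤ p) :
    ∃ C : ℝ≥0, ∀ (E : Type) [NormedAddCommGroup E] [NormedSpace ℂ E] [CompleteSpace E]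
      (x : ℕ → E) (z : ℂ) (m : ℕ), z ∈ disk →
      (Summable fun k => ‖eulerCoeff x k‖ * ‖z‖ ^ k) →
      (1 / 2 : ℝ) ^ m / 2 ≤ 1 - ‖z‖ → 1 - ‖z‖ ≤ (1 / 2 : ℝ) ^ m →
      ENNReal.ofReal ((1 - ‖z‖) * logWeight s z) * ‖powerSum (eulerCoeff x) z‖ₑ ≤
        ‖z‖ₑ * (C * ∑' n, ENNReal.ofReal (dyadicKernel p n m) * weightedBlock ω s x n) := by
  obtain ⟨C, hC, h⟩ := exists_norm_block_deriv_le hω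
  refine ⟨(C * (32 * 4 ^ p)).toNNReal, fun E _ _ _ x z m hz hsum h1 h2 => ?_⟩
  have hz' : ‖z‖ < 1 := mem_ball_zero_iff.1 hz
  refine (mul_le_mul_right (enorm_powerSum_eulerCoeff_le hω x hsum) _).trans ?_
  rw [← ENNReal.tsum_mul_left, ← ENNReal.tsum_mul_left, ← ENNReal.tsum_mul_left]
  refine ENNReal.tsum_le_tsum fun n => ?_
  have hfin := hω.diskNorm_block_ne_top x n
  set B := (diskNorm (block ω x n)).toReal with hB
  have hB0 : 0 ≤ B := ENNReal.toReal_nonneg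
  have eB : diskNorm (block ω x n) = ENNReal.ofReal B := (ENNReal.ofReal_toReal hfin).symm
  have key := h E x n B ((diskNorm_le_iff hB0).1 eB.le) z hz
  have hl := logWeight_nonneg s hz
  have hw := weight_mul_le hs n h1 h2
  rw [weightedBlock, eB, ← ofReal_norm, ← ofReal_norm,
    ← ENNReal.ofReal_mul (by apply mul_nonneg <;> linarith)]
  change _ ≤ _ * (ENNReal.ofReal _ * _)
  rw [← ENNReal.ofReal_mul (by positivity), ← ENNReal.ofReal_mul (dyadicKernel_nonneg _ _ _),
    ← ENNReal.ofReal_mul (by positivity), ← ENNReal.ofReal_mul (norm_nonneg _)]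
  refine ENNReal.ofReal_le_ofReal ?_
  calc _ ≤ (1 - ‖z‖) * logWeight s z *
        (C * (‖z‖ * (2 ^ n * Real.exp (-(2 ^ n * (1 - ‖z‖) / 2)))) * B) := by
        gcongr
    _ = C * ‖z‖ * B * ((1 - ‖z‖) * logWeight s z *
        (2 ^ n * Real.exp (-(2 ^ n * (1 - ‖z‖) / 2)))) := by ring
    _ ≤ C * ‖z‖ * B * ((32 * 4 ^ p) * dyadicKernel p n m * ((n : ℝ) + 1) ^ s) := by gcongr
    _ = _ := by ring

/-- The bounds `1 - e^{-x} ≤ x` and `e^{-y} ≤ 1 / (1 + y)`, with `x = 2^(-n)` and `y = x / 2`. -/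
lemma one_sub_bounds {r : ℝ} {n : ℕ} (h1 : Real.exp (-(1 / 2 ^ n)) ≤ r)
    (h2 : r ≤ Real.exp (-(1 / 2 ^ n / 2))) :
    (1 / 2 : ℝ) ^ n / 4 ≤ 1 - r ∧ 1 - r ≤ (1 / 2 : ℝ) ^ n := by
  have e : (1 : ℝ) / 2 ^ n = (1 / 2) ^ n := by rw [div_pow, one_pow]
  rw [e] at h1 h2
  have hx0 : (0 : ℝ) < (1 / 2) ^ n := by positivity
  have hx1 : (1 / 2 : ℝ) ^ n ≤ 1 := pow_le_one₀ (by norm_num) (by norm_num)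
  constructor
  · have h3 := Real.add_one_le_exp ((1 / 2 : ℝ) ^ n / 2)
    have h4 : Real.exp (-((1 / 2 : ℝ) ^ n / 2)) ≤ 1 / (1 + (1 / 2) ^ n / 2) := by
      rw [Real.exp_neg, ← one_div]
      exact one_div_le_one_div_of_le (by positivity) (by linarith)
    have h5 : 1 / (1 + (1 / 2 : ℝ) ^ n / 2) ≤ 1 - (1 / 2) ^ n / 4 := by
      rw [div_le_iff₀ (by positivity)]; nlinarith
    linarith
  · have := Real.add_one_le_exp (-(1 / 2 : ℝ) ^ n)
    linarith

/-- The blocks are controlled by the derivative. -/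
theorem exists_weightedBlock_succ_le {ω : ℝ → ℝ} (hω : IsCutoff ω) {s : ℝ} {p : ℕ}
    (hs : |s| ≤ p) :
    ∃ C : ℝ≥0, ∀ (E : Type) [NormedAddCommGroup E] [NormedSpace ℂ E] [CompleteSpace E]
      (x : ℕ → E) (n : ℕ) (r : ℝ) (B : ℝ),
      Real.exp (-(1 / 2 ^ n)) ≤ r → r ≤ Real.exp (-(1 / 2 ^ n / 2)) →
      (Summable fun k => ‖eulerCoeff x k‖ * r ^ k) →
      (∀ w, ‖w‖ = r → ‖powerSum (eulerCoeff x) w‖ ≤ B) →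
      weightedBlock ω s x (n + 1) ≤ C * ENNReal.ofReal ((1 - r) * logWeight s r * B) := by
  obtain ⟨C, hC, h⟩ := exists_norm_block_succ_le hω
  refine ⟨(C * 4 * 4 ^ p).toNNReal, fun E _ _ _ x n r B h1 h2 hsum hB => ?_⟩
  have hr0 : 0 < r := (Real.exp_pos _).trans_le h1
  have hnr : ‖(r : ℂ)‖ = r := by simp [hr0.le]
  obtain ⟨h3, h4⟩ := one_sub_bounds h1 h2
  have hx0 : (0 : ℝ) < (1 / 2) ^ n := by positivity
  have hB0 : 0 ≤ B := (norm_nonneg _).trans (hB r hnr)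
  have hl := logWeight_nonneg s (z := (r : ℂ)) (by
    rw [disk, mem_ball_zero_iff, hnr]; linarith)
  -- By the maximum principle a bound at radius `r` passes to the smaller radius `exp (-2^(-n))`. A
  -- whole interval of radii is thus allowed, which is needed for averaging in the `L¹` case.
  have key := h E x n B
    (hsum.of_nonneg_of_le (fun k => by positivity) fun k => by gcongr)
    (fun w hw => norm_powerSum_le_of_sphere hr0 hsum hB (by rwa [hw]))
  have hd : diskNorm (block ω x (n + 1)) ≤ ENNReal.ofReal (C * (1 / 2 ^ n) * B) :=
    (diskNorm_le_iff (by positivity)).2 fun z hz => key z (mem_ball_zero_iff.1 hz).le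
  have hq := (logWeight_comparable hs (z := (r : ℂ)) (m := n) (by rwa [hnr]) (by rwa [hnr])
    (q := n + 2) (by linarith) le_rfl).2
  have hcast : ((n + 1 : ℕ) : ℝ) + 1 = n + 2 := by push_cast; ring
  rw [weightedBlock, hcast]
  change _ ≤ ENNReal.ofReal _ * _
  refine (mul_le_mul_right hd _).trans ?_
  rw [← ENNReal.ofReal_mul (by positivity), ← ENNReal.ofReal_mul (by positivity)]
  refine ENNReal.ofReal_le_ofReal ?_
  have e : (1 : ℝ) / 2 ^ n = (1 / 2) ^ n := by rw [div_pow, one_pow]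
  rw [e]
  calc _ ≤ (4 ^ p * logWeight s r) * (C * (4 * (1 - r)) * B) := by
        gcongr
        linarith
    _ = _ := by ring

lemma weightedBlock_zero_le {ω : ℝ → ℝ} (hω : IsCutoff ω) (s : ℝ) (x : ℕ → E) :
    weightedBlock ω s x 0 ≤ ‖x 0‖ₑ + ‖x 1‖ₑ := by
  simp only [weightedBlock, Nat.cast_zero, zero_add, Real.one_rpow, ENNReal.ofReal_one, one_mul]
  refine iSup₂_le fun z hz => ?_
  rw [block, powerSum_eq_sum (L := 2) fun k hk => by
    rw [hω.vcoef_eq_zero_of_ge (by simpa using hk)]; simp]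
  simp only [Finset.sum_range_succ, Finset.range_zero, Finset.sum_empty, vcoef]
  simp only [pow_zero, Nat.ofNat_pos, ↓reduceIte, Complex.ofReal_one, one_smul, zero_add, pow_one,
    Nat.one_lt_ofNat]
  refine (enorm_add_le _ _).trans ?_
  gcongr
  rw [enorm_smul]
  refine mul_le_of_le_one_left' ?_
  rw [← ofReal_norm, ← ENNReal.ofReal_one]
  exact ENNReal.ofReal_le_ofReal (mem_ball_zero_iff.1 hz).le

end Weights

/-! ### The case `E = ℂ`: the spaces `𝔅` and `𝔟`. -/

section SupNorm

lemma IsCutoff.V_eq_sum {ω : ℝ → ℝ} (hω : IsCutoff ω) (n : ℕ) :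
    V ω n = fun z => ∑ k ∈ Finset.range (2 ^ (n + 1)), (vcoef ω n k : ℂ) * z ^ k := by
  funext z
  cases n with
  | zero => simp [V, vcoef, Finset.sum_range_succ]
  | succ n =>
    refine Finset.sum_subset (fun k hk => ?_) fun k _ hk' => ?_
    · simp only [Finset.mem_Ico, Finset.mem_range] at hk ⊢
      exact hk.2
    · have hk : k < 2 ^ n := by
        by_contra h
        exact hk' (Finset.mem_Ico.2 ⟨not_lt.1 h, Finset.mem_range.1 ‹_›⟩)
      have := hω.vcoef_succ_eq_zero_of_le hk.le
      rw [vcoef] at this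
      rw [this]; simp

lemma IsCutoff.taylorCoeff_V {ω : ℝ → ℝ} (hω : IsCutoff ω) (n k : ℕ) :
    taylorCoeff (V ω n) k = vcoef ω n k := by
  rw [taylorCoeff, hω.V_eq_sum, iteratedDeriv_fun_sum fun i _ => by fun_prop]
  simp_rw [iteratedDeriv_const_mul_field, iteratedDeriv_fun_pow_zero]
  have hk : (k.factorial : ℂ) ≠ 0 := by exact_mod_cast k.factorial_ne_zero
  simp only [Nat.cast_ite, Nat.cast_zero, mul_ite, mul_zero, Finset.sum_ite_eq, Finset.mem_range]
  split_ifs with h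
  · field_simp
  · rw [hω.vcoef_eq_zero_of_ge (not_lt.1 h)]; simp

lemma IsCutoff.hadamard_V {ω : ℝ → ℝ} (hω : IsCutoff ω) (f : ℂ → ℂ) (n : ℕ) :
    hadamard (V ω n) f = block ω (taylorCoeff f) n := by
  funext z
  simp only [hadamard, block, powerSum, hω.taylorCoeff_V, smul_eq_mul]
  exact tsum_congr fun k => by ring

lemma IsCutoff.blockInf_eq {ω : ℝ → ℝ} (hω : IsCutoff ω) (α : ℝ) (f : ℂ → ℂ) (n : ℕ) :
    blockInf ω α f n = weightedBlock ω (-α) (taylorCoeff f) n := by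
  rw [blockInf, hω.hadamard_V]; rfl

@[simp] lemma taylorCoeff_zero (f : ℂ → ℂ) : taylorCoeff f 0 = f 0 := by simp [taylorCoeff]

@[simp] lemma taylorCoeff_one (f : ℂ → ℂ) : taylorCoeff f 1 = deriv f 0 := by simp [taylorCoeff]

lemma IsHol.deriv {f : ℂ → ℂ} (hf : IsHol f) : IsHol (deriv f) :=
  DifferentiableOn.deriv hf Metric.isOpen_ball


lemma IsHol.hasSum_eulerCoeff {f : ℂ → ℂ} (hf : IsHol f) {w : ℂ} (hw : w ∈ disk) :
    HasSum (fun k => w ^ k • eulerCoeff (taylorCoeff f) k) (w * _root_.deriv f w) := by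
  have h := (Complex.hasSum_taylorSeries_on_ball hf.deriv hw).mul_left w
  rw [← hasSum_nat_add_iff' 1]
  simp only [Finset.range_one, Finset.sum_singleton, eulerCoeff, Nat.cast_zero, zero_smul,
    smul_zero, sub_zero]
  refine h.congr_fun fun k => ?_
  have hk : (k.factorial : ℂ) ≠ 0 := by exact_mod_cast k.factorial_ne_zero
  have hk1 : (k : ℂ) + 1 ≠ 0 := by exact_mod_cast k.succ_ne_zero
  rw [taylorCoeff, Nat.factorial_succ, iteratedDeriv_succ']
  simp only [smul_eq_mul, sub_zero]
  push_cast
  rw [pow_succ]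
  field_simp

lemma IsHol.powerSum_eulerCoeff {f : ℂ → ℂ} (hf : IsHol f) {w : ℂ} (hw : w ∈ disk) :
    powerSum (eulerCoeff (taylorCoeff f)) w = w * _root_.deriv f w :=
  (hf.hasSum_eulerCoeff hw).tsum_eq

lemma IsHol.summable_eulerCoeff {f : ℂ → ℂ} (hf : IsHol f) {r : ℝ} (h0 : 0 ≤ r) (h1 : r < 1) :
    Summable fun k => ‖eulerCoeff (taylorCoeff f) k‖ * r ^ k := by
  have hr : ‖(r : ℂ)‖ = r := by simp [h0]
  refine (hf.hasSum_eulerCoeff (w := r) ?_).summable.norm.congr fun k => ?_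
  · rwa [disk, mem_ball_zero_iff, hr]
  · rw [norm_smul, norm_pow, hr, mul_comm]

lemma logWeight_pos (s : ℝ) {z : ℂ} (hz : z ∈ disk) : 0 < logWeight s z := by
  have hz' : ‖z‖ < 1 := mem_ball_zero_iff.1 hz
  refine Real.rpow_pos_of_pos (Real.log_pos ?_) _
  rw [lt_div_iff₀ (by linarith)]
  linarith [norm_nonneg z]

lemma logWeight_congr (s : ℝ) {z w : ℂ} (h : ‖z‖ = ‖w‖) : logWeight s z = logWeight s w := by
  rw [logWeight, logWeight, h]

lemma logWeight_neg (s : ℝ) {z : ℂ} (hz : z ∈ disk) : logWeight (-s) z = (logWeight s z)⁻¹ := by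
  have hz' : ‖z‖ < 1 := mem_ball_zero_iff.1 hz
  refine Real.rpow_neg (Real.log_nonneg ?_) _
  rw [le_div_iff₀ (by linarith)]
  linarith [norm_nonneg z]

/-- Passes between the weighted supremum and the bounds defining `O` and `o`. -/
lemma weight_mul_le_iff (α : ℝ) {z : ℂ} (hz : z ∈ disk) (t c : ℝ) :
    (1 - ‖z‖) * logWeight (-α) z * t ≤ c ↔ t ≤ c * ‖(1 - ‖z‖)⁻¹ * logWeight α z‖ := by
  have hz' : 0 < 1 - ‖z‖ := by have := mem_ball_zero_iff.1 hz; linarith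
  have hl := logWeight_pos α hz
  rw [logWeight_neg α hz, Real.norm_of_nonneg (by positivity), ← div_eq_mul_inv, mul_comm,
    ← le_div_iff₀ (by positivity)]
  have : c / ((1 - ‖z‖) / logWeight α z) = c * ((1 - ‖z‖)⁻¹ * logWeight α z) := by field_simp
  rw [this]

lemma continuousOn_logWeight (s : ℝ) : ContinuousOn (logWeight s) disk := by
  have h1 : ∀ z ∈ disk, 0 < 1 - ‖z‖ := fun z hz => by
    have := mem_ball_zero_iff.1 hz; linarith
  refine ContinuousOn.rpow_const (ContinuousOn.log ?_ fun z hz => ?_) fun z hz => Or.inl ?_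
  · exact ContinuousOn.div continuousOn_const (by fun_prop) fun z hz => (h1 z hz).ne'
  · exact (div_pos two_pos (h1 z hz)).ne'
  · refine (Real.log_pos ?_).ne'
    rw [lt_div_iff₀ (h1 z hz)]
    linarith [norm_nonneg z]

lemma eventually_boundaryFilter_iff {P : ℂ → Prop} :
    (∀ᶠ z in boundaryFilter, P z) ↔ ∃ ρ < (1 : ℝ), ∀ z, ρ < ‖z‖ → ‖z‖ < 1 → P z := by
  have := (nhdsLT_basis (1 : ℝ)).comap (fun z : ℂ => ‖z‖)
  rw [boundaryFilter, this.eventually_iff]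
  simp [and_imp]

section Sup

variable {ω : ℝ → ℝ} (hω : IsCutoff ω) {s : ℝ} {p : ℕ} (hs : |s| ≤ p)
include hω hs

lemma exists_weightedBlock_succ_le_of_circle : ∃ C : ℝ≥0, ∀ f : ℂ → ℂ, IsHol f → ∀ (n : ℕ) (K : ℝ),
    (∀ w, ‖w‖ = Real.exp (-(1 / 2 ^ n)) →
      (1 - ‖w‖) * logWeight s w * ‖deriv f w‖ ≤ K) →
    weightedBlock ω s (taylorCoeff f) (n + 1) ≤ C * ENNReal.ofReal K := by
  obtain ⟨C, h⟩ := exists_weightedBlock_succ_le hω hs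
  refine ⟨C, fun f hf n K hK => ?_⟩
  set r := Real.exp (-(1 / 2 ^ n)) with hr
  have hr0 : 0 < r := Real.exp_pos _
  have hr1 : r < 1 := by rw [hr, Real.exp_lt_one_iff]; simp
  have hnr : ‖(r : ℂ)‖ = r := by simp [hr0.le]
  have hrd : (r : ℂ) ∈ disk := by rwa [disk, mem_ball_zero_iff, hnr]
  have hpos : 0 < (1 - r) * logWeight s r := mul_pos (by linarith) (logWeight_pos s hrd)
  -- This `B` makes the weights at radius `r` cancel, leaving `K`.
  have := h ℂ (taylorCoeff f) n r (K / ((1 - r) * logWeight s r)) le_rfl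
    (by
      rw [hr]
      refine Real.exp_le_exp.2 (neg_le_neg ?_)
      have : (0 : ℝ) < 1 / 2 ^ n := by positivity
      linarith)
    (hf.summable_eulerCoeff hr0.le hr1) (fun w hw => by
      have hwd : w ∈ disk := by rwa [disk, mem_ball_zero_iff, hw]
      rw [hf.powerSum_eulerCoeff hwd, norm_mul, hw, le_div_iff₀ hpos]
      have h1 := hK w hw
      rw [hw, logWeight_congr s (hw.trans hnr.symm)] at h1
      have h2 : 0 ≤ (1 - r) * logWeight s r * ‖deriv f w‖ := by positivity
      nlinarith)
  rwa [mul_div_cancel₀ _ hpos.ne'] at this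

/-- For `z ≠ 0` the factor `‖z‖` of `z f'` cancels against the one kept in Bernstein's bound; at the
origin `f' 0` is a coefficient of the block `0`. -/
lemma exists_weight_mul_enorm_deriv_le : ∃ C : ℝ≥0, ∀ f : ℂ → ℂ, IsHol f → ∀ (z : ℂ) (m : ℕ),
    z ∈ disk → (1 / 2 : ℝ) ^ m / 2 ≤ 1 - ‖z‖ → 1 - ‖z‖ ≤ (1 / 2 : ℝ) ^ m →
    ENNReal.ofReal ((1 - ‖z‖) * logWeight s z) * ‖deriv f z‖ₑ ≤
      C * ∑' n, ENNReal.ofReal (dyadicKernel p n m) *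
        weightedBlock ω s (taylorCoeff f) n := by
  obtain ⟨C, h⟩ := exists_weight_mul_enorm_le hω hs
  refine ⟨C + (logWeight s 0).toNNReal, fun f hf z m hz h1 h2 => ?_⟩
  have hz' : ‖z‖ < 1 := mem_ball_zero_iff.1 hz
  rcases eq_or_ne z 0 with rfl | hz0
  · have hm : m = 0 := by
      by_contra hm
      have : (1 / 2 : ℝ) ^ m < 1 := pow_lt_one₀ (by norm_num) (by norm_num) hm
      rw [norm_zero] at h2
      linarith
    subst hm
    have hfin := hω.diskNorm_block_ne_top (taylorCoeff f) 0
    have hd : ‖deriv f 0‖ₑ ≤ weightedBlock ω s (taylorCoeff f) 0 := by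
      have := norm_coeff_one_le_of_block_zero hω (taylorCoeff f)
        ((diskNorm_le_iff ENNReal.toReal_nonneg).1 (ENNReal.ofReal_toReal hfin).ge)
      rw [weightedBlock, ← ofReal_norm, ← ENNReal.ofReal_toReal hfin]
      simpa using ENNReal.ofReal_le_ofReal this
    calc _ ≤ ((logWeight s 0).toNNReal : ℝ≥0∞) * weightedBlock ω s (taylorCoeff f) 0 := by
          rw [norm_zero, sub_zero, one_mul]
          exact mul_le_mul' le_rfl hd
      _ ≤ ((C + (logWeight s 0).toNNReal : ℝ≥0) : ℝ≥0∞) *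
          (ENNReal.ofReal (dyadicKernel p 0 0) * weightedBlock ω s (taylorCoeff f) 0) := by
          gcongr
          · exact_mod_cast le_add_self
          · simp [dyadicKernel]
      _ ≤ _ := by
          gcongr
          exact ENNReal.le_tsum 0
  · have key := h ℂ (taylorCoeff f) z m hz (hf.summable_eulerCoeff (norm_nonneg _) hz') h1 h2
    rw [hf.powerSum_eulerCoeff hz, enorm_mul, mul_left_comm,
      ENNReal.mul_le_mul_iff_right (by simpa using hz0) enorm_ne_top] at key
    refine key.trans ?_
    gcongr
    exact_mod_cast le_self_add

end Sup

lemma enorm_coeff_zero_le {E : Type*} [NormedAddCommGroup E] [NormedSpace ℂ E] {ω : ℝ → ℝ}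
    (hω : IsCutoff ω) (s : ℝ) (x : ℕ → E) : ‖x 0‖ₑ ≤ weightedBlock ω s x 0 := by
  have h0 : block ω x 0 0 = x 0 := by
    rw [block, powerSum_eq_sum (L := 2) fun k hk => by
      rw [hω.vcoef_eq_zero_of_ge (by simpa using hk)]; simp]
    simp [Finset.sum_range_succ, vcoef]
  simp only [weightedBlock, Nat.cast_zero, zero_add, Real.one_rpow, ENNReal.ofReal_one, one_mul]
  rw [← h0]
  exact le_iSup₂ (f := fun z (_ : z ∈ disk) => ‖block ω x 0 z‖ₑ) 0 (by simp [disk])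

theorem exists_blochNorm_comparable {ω : ℝ → ℝ} (hω : IsCutoff ω) (α : ℝ) :
    ∃ C : ℝ≥0, 0 < C ∧ ∀ f : ℂ → ℂ, IsHol f →
      blochNorm α f ≤ C * (⨆ n, blockInf ω α f n) ∧
      (⨆ n, blockInf ω α f n) ≤ C * blochNorm α f := by
  obtain ⟨p, hp⟩ := exists_nat_ge |-α|
  obtain ⟨C1, h1⟩ := exists_weightedBlock_succ_le_of_circle hω hp
  obtain ⟨C2, h2⟩ := exists_weight_mul_enorm_deriv_le hω hp
  obtain ⟨S, -, hS⟩ := exists_tsum_dyadicKernel_le p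
  have h0d : (0 : ℂ) ∈ disk := by simp [disk]
  have hl0 := logWeight_pos (-α) h0d
  set C3 : ℝ≥0 := (logWeight (-α) 0)⁻¹.toNNReal with hC3
  -- `1 + C2 * S` bounds the norm by the blocks; `C1` bounds the blocks `n + 1`, and `1 + C3` the
  -- block `0`, where `C3` recovers `f' 0` from its weighted value.
  refine ⟨1 + C2 * S + C1 + C3, by positivity, fun f hf => ⟨?_, ?_⟩⟩
  · set b := ⨆ n, blockInf ω α f n with hb
    have hbn : ∀ n, weightedBlock ω (-α) (taylorCoeff f) n ≤ b := fun n => by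
      rw [← hω.blockInf_eq]; exact le_iSup _ n
    have e1 : ‖f 0‖ₑ ≤ b := by
      have := (enorm_coeff_zero_le hω (-α) (taylorCoeff f)).trans (hbn 0)
      simpa using this
    have e2 : (⨆ z ∈ disk, ENNReal.ofReal ((1 - ‖z‖) * logWeight (-α) z) * ‖deriv f z‖ₑ) ≤
        C2 * S * b := by
      refine iSup₂_le fun z hz => ?_
      obtain ⟨m, hm1, hm2⟩ := exists_dyadic (norm_nonneg z) (mem_ball_zero_iff.1 hz)
      refine (h2 f hf z m hz hm1 hm2).trans ?_
      rw [mul_assoc]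
      gcongr
      calc _ ≤ ∑' n, ENNReal.ofReal (dyadicKernel p n m) * b := by
            gcongr with n
            exact hbn n
        _ = (∑' n, ENNReal.ofReal (dyadicKernel p n m)) * b := ENNReal.tsum_mul_right
        _ ≤ _ := by gcongr; exact hS m
    calc blochNorm α f ≤ b + C2 * S * b := add_le_add e1 e2
      _ = ((1 + C2 * S : ℝ≥0) : ℝ≥0∞) * b := by push_cast; ring
      _ ≤ _ := by
        exact mul_le_mul' (ENNReal.coe_le_coe.2
          (le_of_le_of_eq (le_self_add (b := C1 + C3)) (by ring))) le_rfl
  · rcases eq_or_ne (blochNorm α f) ∞ with htop | htop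
    · rw [htop, ENNReal.mul_top (by positivity)]; exact le_top
    set K := blochNorm α f with hK
    have hKz : ∀ z ∈ disk, ENNReal.ofReal ((1 - ‖z‖) * logWeight (-α) z) * ‖deriv f z‖ₑ ≤ K :=
      fun z hz => (le_iSup₂ (f := fun z (_ : z ∈ disk) =>
        ENNReal.ofReal ((1 - ‖z‖) * logWeight (-α) z) * ‖deriv f z‖ₑ) z hz).trans le_add_self
    refine iSup_le fun n => ?_
    rw [hω.blockInf_eq]
    cases n with
    | zero =>
      have a0 : ‖f 0‖ₑ ≤ K := le_self_add
      have a1 : ‖deriv f 0‖ₑ ≤ C3 * K := by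
        calc ‖deriv f 0‖ₑ = C3 * (ENNReal.ofReal ((1 - ‖(0 : ℂ)‖) * logWeight (-α) 0) *
              ‖deriv f 0‖ₑ) := by
              change _ = ENNReal.ofReal _ * _
              rw [← mul_assoc, ← ENNReal.ofReal_mul (by positivity), norm_zero, sub_zero, one_mul,
                inv_mul_cancel₀ hl0.ne', ENNReal.ofReal_one, one_mul]
          _ ≤ _ := by gcongr; exact hKz 0 h0d
      calc _ ≤ ‖f 0‖ₑ + ‖deriv f 0‖ₑ := by
            simpa using weightedBlock_zero_le hω (-α) (taylorCoeff f)
        _ ≤ K + C3 * K := add_le_add a0 a1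
        _ = ((1 + C3 : ℝ≥0) : ℝ≥0∞) * K := by push_cast; ring
        _ ≤ _ := by
          exact mul_le_mul' (ENNReal.coe_le_coe.2
            (le_of_le_of_eq (le_self_add (b := C2 * S + C1)) (by ring))) le_rfl
    | succ n =>
      have := h1 f hf n K.toReal fun w hw => by
        have hwd : w ∈ disk := by
          rw [disk, mem_ball_zero_iff, hw, Real.exp_lt_one_iff]; simp
        have := hKz w hwd
        have hw1 : 0 ≤ 1 - ‖w‖ := by have := mem_ball_zero_iff.1 hwd; linarith
        rw [← ofReal_norm, ← ENNReal.ofReal_mul (mul_nonneg hw1 (logWeight_nonneg _ hwd))] at this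
        exact (ENNReal.ofReal_le_iff_le_toReal htop).1 this
      rw [ENNReal.ofReal_toReal htop] at this
      refine this.trans ?_
      gcongr
      rw [add_right_comm]
      exact le_add_self

/-- The `O` condition only concerns points near the boundary; on the remaining closed ball,
continuity and compactness give a bound. -/
lemma IsHol.memBloch_iff {f : ℂ → ℂ} (hf : IsHol f) (α : ℝ) :
    MemBloch α f ↔ blochNorm α f < ∞ := by
  have hw0 : ∀ z ∈ disk, 0 ≤ (1 - ‖z‖) * logWeight (-α) z := fun z hz => by
    have := mem_ball_zero_iff.1 hz
    exact mul_nonneg (by linarith) (logWeight_nonneg _ hz)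
  have hdisk : ∀ z : ℂ, ‖z‖ < 1 → z ∈ disk := fun z hz => by rwa [disk, mem_ball_zero_iff]
  constructor
  · rintro ⟨-, hO⟩
    obtain ⟨c, hc⟩ := hO.bound
    obtain ⟨ρ, hρ, h⟩ := eventually_boundaryFilter_iff.1 hc
    have hsub : Metric.closedBall (0 : ℂ) ρ ⊆ disk := Metric.closedBall_subset_ball hρ
    have hcont : ContinuousOn (fun z => (1 - ‖z‖) * logWeight (-α) z * ‖_root_.deriv f z‖)
        (Metric.closedBall 0 ρ) :=
      ((ContinuousOn.mul (by fun_prop) (continuousOn_logWeight _)).mul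
        hf.deriv.continuousOn.norm).mono hsub
    obtain ⟨M, hM⟩ := (isCompact_closedBall (0 : ℂ) ρ).exists_bound_of_continuousOn hcont
    rw [blochNorm, ENNReal.add_lt_top]
    refine ⟨enorm_lt_top, lt_of_le_of_lt (iSup₂_le fun z hz => ?_)
      (ENNReal.ofReal_lt_top (r := max c M))⟩
    rw [← ofReal_norm, ← ENNReal.ofReal_mul (hw0 z hz)]
    refine ENNReal.ofReal_le_ofReal ?_
    rcases le_or_gt ‖z‖ ρ with hz1 | hz1
    · exact ((le_abs_self _).trans (hM z (by simpa using hz1))).trans (le_max_right _ _)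
    · refine le_trans ?_ (le_max_left c M)
      exact (weight_mul_le_iff α hz _ _).2 (h z hz1 (mem_ball_zero_iff.1 hz))
  · intro h
    refine ⟨hf, Asymptotics.IsBigO.of_bound (blochNorm α f).toReal ?_⟩
    refine eventually_boundaryFilter_iff.2 ⟨0, one_pos, fun z _ hz => ?_⟩
    refine (weight_mul_le_iff α (hdisk z hz) _ _).1 ?_
    rw [← ENNReal.ofReal_le_iff_le_toReal h.ne, ENNReal.ofReal_mul (hw0 z (hdisk z hz)),
      ofReal_norm]
    exact (le_iSup₂ (f := fun z (_ : z ∈ disk) =>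
        ENNReal.ofReal ((1 - ‖z‖) * logWeight (-α) z) * ‖_root_.deriv f z‖ₑ) z
        (hdisk z hz)).trans le_add_self

/-- The action on `c₀`: the finitely many terms `n < n₀` tend to `0` with the kernel, and the tail
is at most `δ` times the sum of the kernel over `n`. -/
lemma tendsto_tsum_dyadicKernel_mul (p : ℕ) {b : ℕ → ℝ≥0∞} (hfin : ∀ n, b n ≠ ∞)
    (hb : Tendsto b atTop (𝓝 0)) :
    Tendsto (fun m => ∑' n, ENNReal.ofReal (dyadicKernel p n m) * b n) atTop (𝓝 0) := by
  obtain ⟨S, -, hS⟩ := exists_tsum_dyadicKernel_le p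
  rw [ENNReal.tendsto_nhds_zero]
  intro ε hε
  set δ : ℝ≥0∞ := ε / 2 / (S + 1) with hδ
  have hSt : (S : ℝ≥0∞) + 1 ≠ ∞ := by simp
  have hδ0 : 0 < δ := ENNReal.div_pos (ENNReal.half_pos hε.ne').ne' hSt
  have hSδ : S * δ ≤ ε / 2 := by
    calc S * δ ≤ (S + 1) * (ε / 2 / (S + 1)) := by gcongr; exact le_self_add
      _ = ε / 2 := ENNReal.mul_div_cancel (by simp) hSt
  obtain ⟨n₀, hn₀⟩ := eventually_atTop.1 ((ENNReal.tendsto_nhds_zero.1 hb) δ hδ0)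
  have hsum : Tendsto (fun m => ∑ n ∈ Finset.range n₀, ENNReal.ofReal (dyadicKernel p n m) * b n)
      atTop (𝓝 0) := by
    rw [← Finset.sum_const_zero (s := Finset.range n₀)]
    refine tendsto_finsetSum _ fun n _ => ?_
    have := ENNReal.Tendsto.mul_const (b := b n)
      (ENNReal.tendsto_ofReal (tendsto_dyadicKernel p n)) (Or.inr (hfin n))
    simpa using this
  filter_upwards [(ENNReal.tendsto_nhds_zero.1 hsum) (ε / 2) (ENNReal.half_pos hε.ne')] with m hm
  calc _ ≤ ∑' n, ((if n ∈ Finset.range n₀ then ENNReal.ofReal (dyadicKernel p n m) * b n else 0) +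
        ENNReal.ofReal (dyadicKernel p n m) * δ) := by
        refine ENNReal.tsum_le_tsum fun n => ?_
        split_ifs with h
        · exact le_self_add
        · rw [zero_add]
          gcongr
          exact hn₀ n (by simpa using h)
    _ = ∑ n ∈ Finset.range n₀, ENNReal.ofReal (dyadicKernel p n m) * b n +
        (∑' n, ENNReal.ofReal (dyadicKernel p n m)) * δ := by
        rw [ENNReal.tsum_add, ENNReal.tsum_mul_right,
          tsum_eq_sum (s := Finset.range n₀) fun n hn => if_neg hn]
        congr 1
        exact Finset.sum_congr rfl fun n hn => if_pos hn
    _ ≤ ε / 2 + ε / 2 := by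
        refine add_le_add hm (le_trans ?_ hSδ)
        gcongr
        exact hS m
    _ = ε := ENNReal.add_halves ε

theorem memLittleBloch_iff {ω : ℝ → ℝ} (hω : IsCutoff ω) (α : ℝ) {f : ℂ → ℂ} (hf : IsHol f) :
    MemLittleBloch α f ↔ Tendsto (blockInf ω α f) atTop (𝓝 0) := by
  obtain ⟨p, hp⟩ := exists_nat_ge |-α|
  obtain ⟨C1, h1⟩ := exists_weightedBlock_succ_le_of_circle hω hp
  obtain ⟨C2, h2⟩ := exists_weight_mul_enorm_deriv_le hω hp
  have hdisk : ∀ z : ℂ, ‖z‖ < 1 → z ∈ disk := fun z hz => by rwa [disk, mem_ball_zero_iff]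
  have heq : blockInf ω α f = weightedBlock ω (-α) (taylorCoeff f) :=
    funext (hω.blockInf_eq α f)
  rw [heq]
  constructor
  · rintro ⟨-, ho⟩
    rw [← tendsto_add_atTop_iff_nat 1, ENNReal.tendsto_nhds_zero]
    intro ε hε
    obtain ⟨δ, hδ0, hδ⟩ : ∃ δ : ℝ≥0, 0 < δ ∧ C1 * (δ : ℝ≥0∞) ≤ ε := by
      rcases eq_or_ne ε ∞ with rfl | hεt
      · exact ⟨1, one_pos, le_top⟩
      lift ε to ℝ≥0 using hεt
      have hε' : 0 < ε := by exact_mod_cast hε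
      refine ⟨ε / (C1 + 1), by positivity, ?_⟩
      rw [← ENNReal.coe_mul]
      refine ENNReal.coe_le_coe.2 ?_
      rw [mul_div_assoc', div_le_iff₀ (by positivity), mul_comm]
      gcongr
      exact le_self_add
    obtain ⟨ρ, hρ, h⟩ := eventually_boundaryFilter_iff.1 (ho.bound hδ0)
    have hlim : Tendsto (fun n : ℕ => Real.exp (-(1 / 2 ^ n))) atTop (𝓝 1) := by
      have : Tendsto (fun n : ℕ => (1 / 2 : ℝ) ^ n) atTop (𝓝 0) :=
        tendsto_pow_atTop_nhds_zero_of_lt_one (by norm_num) (by norm_num)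
      have := (Real.continuous_exp.tendsto _).comp this.neg
      rw [neg_zero, Real.exp_zero] at this
      refine this.congr fun n => ?_
      simp
    filter_upwards [hlim.eventually (lt_mem_nhds hρ)] with n hn
    refine (h1 f hf n δ fun w hw => ?_).trans (by simpa using hδ)
    have hw1 : ‖w‖ < 1 := by rw [hw, Real.exp_lt_one_iff]; simp
    exact (weight_mul_le_iff α (hdisk w hw1) _ _).2 (h w (by rwa [hw]) hw1)
  · intro hb
    have hfin : ∀ n, weightedBlock ω (-α) (taylorCoeff f) n ≠ ∞ := fun n =>
      ENNReal.mul_ne_top ENNReal.ofReal_ne_top (hω.diskNorm_block_ne_top _ n)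
    have hT := ENNReal.Tendsto.const_mul (a := (C2 : ℝ≥0∞))
      (tendsto_tsum_dyadicKernel_mul p hfin hb) (Or.inr ENNReal.coe_ne_top)
    rw [mul_zero] at hT
    refine ⟨hf, Asymptotics.IsLittleO.of_bound fun c hc => ?_⟩
    obtain ⟨m₀, hm₀⟩ := eventually_atTop.1
      ((ENNReal.tendsto_nhds_zero.1 hT) (ENNReal.ofReal c) (ENNReal.ofReal_pos.2 hc))
    -- Beyond this radius the dyadic index `m` of `z` is at least `m₀`.
    refine eventually_boundaryFilter_iff.2 ⟨1 - (1 / 2) ^ (m₀ + 1), ?_, fun z hz hz1 => ?_⟩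
    · have : (0 : ℝ) < (1 / 2) ^ (m₀ + 1) := by positivity
      linarith
    have hzd := hdisk z hz1
    obtain ⟨m, hm1, hm2⟩ := exists_dyadic (norm_nonneg z) hz1
    have hm : m₀ ≤ m := by
      have : (1 / 2 : ℝ) ^ (m + 1) < (1 / 2) ^ (m₀ + 1) := by rw [pow_succ]; linarith
      have := (pow_lt_pow_iff_right_of_lt_one₀ (by norm_num) (by norm_num)).1 this
      omega
    refine (weight_mul_le_iff α hzd _ _).1 ?_
    have := (h2 f hf z m hzd hm1 hm2).trans (hm₀ m hm)
    have hw0 : 0 ≤ (1 - ‖z‖) * logWeight (-α) z :=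
      mul_nonneg (by linarith) (logWeight_nonneg _ hzd)
    rw [← ofReal_norm, ← ENNReal.ofReal_mul hw0, ENNReal.ofReal_le_ofReal_iff hc.le] at this
    exact this

end SupNorm

/-! ### The case `E = L¹` of the circle: integral means and polar coordinates. -/

section Circle

open MeasureTheory

instance fact_two_pi_pos : Fact (0 < 2 * Real.pi) := ⟨Real.two_pi_pos⟩

/-- Normalized Haar measure on `ℝ / 2πℤ`. -/
noncomputable abbrev circleMeasure : Measure (AddCircle (2 * Real.pi)) := AddCircle.haarAddCircle

/-- The coefficients of the `L¹`-valued function `w ↦ (t ↦ f (w e^{it}))`. -/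
noncomputable def circleCoeff (a : ℕ → ℂ) (k : ℕ) : Lp ℂ 1 circleMeasure :=
  a k • ContinuousMap.toLp 1 circleMeasure ℂ (fourier (T := 2 * Real.pi) k)

/-- The integral mean `M₁(|w|, h)`. -/
noncomputable def meanOne (h : ℂ → ℂ) (w : ℂ) : ℝ≥0∞ :=
  ∫⁻ t, ‖h (w * (AddCircle.toCircle t : ℂ))‖ₑ ∂circleMeasure

lemma enorm_toLp (g : C(AddCircle (2 * Real.pi), ℂ)) :
    ‖ContinuousMap.toLp 1 circleMeasure ℂ g‖ₑ = ∫⁻ t, ‖g t‖ₑ ∂circleMeasure := by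
  rw [Lp.enorm_def, eLpNorm_congr_ae (ContinuousMap.coeFn_toLp circleMeasure g),
    eLpNorm_one_eq_lintegral_enorm]

lemma norm_circleCoeff (a : ℕ → ℂ) (k : ℕ) : ‖circleCoeff a k‖ = ‖a k‖ := by
  have h : ‖ContinuousMap.toLp 1 circleMeasure ℂ (fourier (T := 2 * Real.pi) k)‖ₑ = 1 := by
    rw [enorm_toLp]
    have : ∀ t, ‖fourier (T := 2 * Real.pi) k t‖ₑ = 1 := fun t => by
      rw [← ofReal_norm, fourier_apply, Circle.norm_coe, ENNReal.ofReal_one]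
    rw [lintegral_congr this]
    simp
  rw [circleCoeff, norm_smul, ← toReal_enorm (ContinuousMap.toLp _ _ _ _), h]
  simp

/-- The series converges uniformly in `t`, so it is summed among continuous functions, where it can
be evaluated pointwise, and then mapped to `L¹`. -/
lemma enorm_powerSum_circleCoeff {a : ℕ → ℂ} {w : ℂ} (hs : Summable fun k => ‖a k‖ * ‖w‖ ^ k) :
    ‖powerSum (circleCoeff a) w‖ₑ = meanOne (powerSum a) w := by
  set g : ℕ → C(AddCircle (2 * Real.pi), ℂ) := fun k => (w ^ k * a k) • fourier k with hg
  have hn : ∀ k, ‖g k‖ ≤ ‖a k‖ * ‖w‖ ^ k := fun k => by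
    rw [hg, ContinuousMap.norm_le _ (by positivity)]
    intro t
    rw [ContinuousMap.smul_apply, norm_smul, fourier_apply, Circle.norm_coe, norm_mul, norm_pow,
      mul_one, mul_comm]
  have hgs : Summable g := Summable.of_norm_bounded hs hn
  have e : powerSum (circleCoeff a) w = ContinuousMap.toLp 1 circleMeasure ℂ (∑' k, g k) := by
    rw [ContinuousLinearMap.map_tsum _ hgs, powerSum]
    refine tsum_congr fun k => ?_
    rw [circleCoeff, smul_smul, map_smul]
  rw [e, enorm_toLp, meanOne]
  refine lintegral_congr fun t => ?_
  congr 1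
  rw [← ContinuousMap.tsum_apply hgs, powerSum]
  refine tsum_congr fun k => ?_
  rw [hg, ContinuousMap.smul_apply, fourier_apply, smul_eq_mul, smul_eq_mul, mul_pow, natCast_zsmul,
    AddCircle.toCircle_nsmul, Circle.coe_pow]
  ring

lemma meanOne_eq_of_norm (h : ℂ → ℂ) (w : ℂ) : meanOne h w = meanOne h ‖w‖ := by
  obtain ⟨τ, hτ⟩ : ∃ τ : AddCircle (2 * Real.pi), w = ‖w‖ * (AddCircle.toCircle τ : ℂ) := by
    refine ⟨(w.arg : ℝ), ?_⟩
    rw [AddCircle.toCircle_apply_mk, div_self Real.two_pi_pos.ne', one_mul, Circle.coe_exp]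
    exact (Complex.norm_mul_exp_arg_mul_I w).symm
  refine Eq.trans (lintegral_congr fun t => ?_) (lintegral_add_left_eq_self
    (fun t => ‖h (‖w‖ * (AddCircle.toCircle t : ℂ))‖ₑ) τ)
  rw [AddCircle.toCircle_add, Circle.coe_mul, ← mul_assoc, ← hτ]

/-- The starting point `t` is free because the Hardy norm integrates from `0` and polar coordinates
from `-π`. -/
lemma lintegral_circleMeasure (F : AddCircle (2 * Real.pi) → ℝ≥0∞) (t : ℝ) :
    ∫⁻ b, F b ∂circleMeasure =
      (ENNReal.ofReal (2 * Real.pi))⁻¹ * ∫⁻ a in Ioc t (t + 2 * Real.pi), F a := by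
  rw [AddCircle.lintegral_preimage, AddCircle.volume_eq_smul_haarAddCircle, lintegral_smul_measure,
    smul_eq_mul, ← mul_assoc, ENNReal.inv_mul_cancel, one_mul]
  · simpa using Real.pi_pos
  · exact ENNReal.ofReal_ne_top

lemma meanOne_eq (h : ℂ → ℂ) (w : ℂ) (t : ℝ) : meanOne h w = (ENNReal.ofReal (2 * Real.pi))⁻¹ *
    ∫⁻ θ in Ioc t (t + 2 * Real.pi), ‖h (w * Complex.exp (θ * Complex.I))‖ₑ := by
  rw [meanOne, lintegral_circleMeasure _ t]
  congr 1
  refine lintegral_congr fun θ => ?_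
  rw [AddCircle.toCircle_apply_mk, div_self Real.two_pi_pos.ne', one_mul, Circle.coe_exp]

lemma hardyNormOne_eq (h : ℂ → ℂ) : hardyNormOne h = ⨆ r ∈ Ioo (0 : ℝ) 1, meanOne h r := by
  refine iSup_congr fun r => iSup_congr fun _ => ?_
  rw [meanOne_eq h r 0, zero_add]

lemma diskNorm_powerSum_circleCoeff {a : ℕ → ℂ} {L : ℕ} (hL : ∀ k, L ≤ k → a k = 0) :
    diskNorm (powerSum (circleCoeff a)) = hardyNormOne (powerSum a) := by
  have hL' : ∀ k, L ≤ k → circleCoeff a k = 0 := fun k hk => by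
    rw [circleCoeff, hL k hk, zero_smul]
  have hen : ∀ w, ‖powerSum (circleCoeff a) w‖ₑ = meanOne (powerSum a) w := fun w =>
    enorm_powerSum_circleCoeff (summable_norm_mul_pow_of_eventually_zero hL _)
  rw [hardyNormOne_eq]
  refine le_antisymm (iSup₂_le fun z hz => ?_) (iSup₂_le fun r hr => ?_)
  · have hz1 : ‖z‖ < 1 := mem_ball_zero_iff.1 hz
    -- The Hardy supremum omits `r = 0`, so small `z` are moved to radius `1 / 2` by the maximum
    -- principle.
    set r := max ‖z‖ (1 / 2) with hr
    have hr0 : 0 < r := lt_max_of_lt_right (by norm_num)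
    have hr1 : r < 1 := max_lt hz1 (by norm_num)
    have hnr : ‖(r : ℂ)‖ = r := by simp [hr0.le]
    refine le_trans ?_ (le_iSup₂ (f := fun (r : ℝ) (_ : r ∈ Ioo (0 : ℝ) 1) =>
      meanOne (powerSum a) r) r ⟨hr0, hr1⟩)
    rw [← hen, enorm_le_iff_norm_le]
    refine norm_powerSum_le_of_sphere hr0 (summable_norm_mul_pow_of_eventually_zero hL' _)
      (fun w hw => ?_) (le_max_left _ _)
    rw [← enorm_le_iff_norm_le, hen, hen, meanOne_eq_of_norm, hw]
  · rw [← hen]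
    refine le_iSup₂ (f := fun z (_ : z ∈ disk) => ‖powerSum (circleCoeff a) z‖ₑ) (r : ℂ) ?_
    rw [disk, mem_ball_zero_iff]
    simpa [abs_of_pos hr.1] using hr.2

lemma IsCutoff.blockOne_eq {ω : ℝ → ℝ} (hω : IsCutoff ω) (α : ℝ) (f : ℂ → ℂ) (n : ℕ) :
    blockOne ω α f n = weightedBlock ω α (circleCoeff (taylorCoeff f)) n := by
  rw [blockOne, hω.hadamard_V, weightedBlock, block, block, ← diskNorm_powerSum_circleCoeff
    (L := 2 ^ (n + 1)) fun k hk => by rw [hω.vcoef_eq_zero_of_ge hk]; simp]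
  congr 3
  funext k
  rw [circleCoeff, circleCoeff, smul_assoc]

lemma eulerCoeff_circleCoeff (a : ℕ → ℂ) :
    eulerCoeff (circleCoeff a) = circleCoeff (eulerCoeff a) := by
  funext k
  rw [eulerCoeff, circleCoeff, circleCoeff, eulerCoeff, smul_assoc]

lemma IsHol.summable_eulerCoeff_circleCoeff {f : ℂ → ℂ} (hf : IsHol f) {r : ℝ} (h0 : 0 ≤ r)
    (h1 : r < 1) : Summable fun k => ‖eulerCoeff (circleCoeff (taylorCoeff f)) k‖ * r ^ k := by
  simp_rw [eulerCoeff_circleCoeff, norm_circleCoeff]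
  exact hf.summable_eulerCoeff h0 h1

lemma IsHol.enorm_powerSum_circle {f : ℂ → ℂ} (hf : IsHol f) {w : ℂ} (hw : w ∈ disk) :
    ‖powerSum (eulerCoeff (circleCoeff (taylorCoeff f))) w‖ₑ = ‖w‖ₑ * meanOne (_root_.deriv f) w := by
  have hw1 : ‖w‖ < 1 := mem_ball_zero_iff.1 hw
  rw [eulerCoeff_circleCoeff, enorm_powerSum_circleCoeff (hf.summable_eulerCoeff (norm_nonneg _) hw1),
    meanOne, meanOne, ← lintegral_const_mul' _ _ enorm_ne_top]
  refine lintegral_congr fun t => ?_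
  have hn : ‖w * (AddCircle.toCircle t : ℂ)‖ = ‖w‖ := by rw [norm_mul, Circle.norm_coe, mul_one]
  rw [hf.powerSum_eulerCoeff (by rwa [disk, mem_ball_zero_iff, hn]), enorm_mul, ← ofReal_norm, hn,
    ofReal_norm]

lemma measurable_logWeight (s : ℝ) : Measurable (logWeight s) := by
  unfold logWeight
  fun_prop

/-- Polar coordinates for the integral defining the norm of `𝔅¹`. -/
lemma IsHol.blochOneNorm_eq {f : ℂ → ℂ} (hf : IsHol f) (α : ℝ) :
    blochOneNorm α f = ‖f 0‖ₑ + 2 * ∫⁻ r in Ioo (0 : ℝ) 1, ENNReal.ofReal (logWeight α r) *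
      ‖powerSum (eulerCoeff (circleCoeff (taylorCoeff f))) r‖ₑ := by
  have hmeas : Measurable fun z : ℂ =>
      disk.indicator (fun z => ‖_root_.deriv f z‖ₑ * ENNReal.ofReal (logWeight α z)) z :=
    (((measurable_deriv f).enorm).mul (measurable_logWeight α).ennreal_ofReal).indicator
      Metric.isOpen_ball.measurableSet
  have hdm : MeasurableSet disk := Metric.isOpen_ball.measurableSet
  have key : ∫⁻ z in disk, ‖_root_.deriv f z‖ₑ * ENNReal.ofReal (logWeight α z) =
      ENNReal.ofReal (2 * Real.pi) * ∫⁻ r in Ioo (0 : ℝ) 1, ENNReal.ofReal (logWeight α r) *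
      ‖powerSum (eulerCoeff (circleCoeff (taylorCoeff f))) r‖ₑ := by
    rw [← lintegral_indicator hdm, ← Complex.lintegral_comp_polarCoord_symm, polarCoord_target,
      Measure.volume_eq_prod, setLIntegral_prod]
    · rw [← lintegral_const_mul' _ _ ENNReal.ofReal_ne_top,
        ← lintegral_indicator measurableSet_Ioi, ← lintegral_indicator measurableSet_Ioo]
      refine lintegral_congr fun r => ?_
      by_cases hr : r ∈ Ioo (0 : ℝ) 1
      · have hnr : ‖(r : ℂ)‖ = r := by simp [hr.1.le]
        have hrd : (r : ℂ) ∈ disk := by rw [disk, mem_ball_zero_iff, hnr]; exact hr.2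
        -- The Jacobian `r` is exactly the factor `‖w‖` of `enorm_powerSum_circle`, so the integrand
        -- becomes the `L¹` norm of `z f'`.
        rw [indicator_of_mem (show r ∈ Ioi (0 : ℝ) from hr.1), indicator_of_mem hr,
          hf.enorm_powerSum_circle hrd, meanOne_eq _ _ (-Real.pi)]
        have hpi : -Real.pi + 2 * Real.pi = Real.pi := by ring
        rw [hpi, setLIntegral_congr Ioo_ae_eq_Ioc]
        have hint : ∀ θ : ℝ, ENNReal.ofReal r • disk.indicator
            (fun z => ‖_root_.deriv f z‖ₑ * ENNReal.ofReal (logWeight α z))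
            (Complex.polarCoord.symm (r, θ)) =
            (ENNReal.ofReal r * ENNReal.ofReal (logWeight α r)) *
              ‖_root_.deriv f (r * Complex.exp (θ * Complex.I))‖ₑ := fun θ => by
          have e1 : Complex.polarCoord.symm (r, θ) = r * Complex.exp (θ * Complex.I) := by
            rw [Complex.polarCoord_symm_apply, Complex.exp_mul_I]
            push_cast; rfl
          have e2 : ‖(r : ℂ) * Complex.exp (θ * Complex.I)‖ = ‖(r : ℂ)‖ := by
            rw [norm_mul, Complex.norm_exp_ofReal_mul_I, mul_one]
          rw [e1, indicator_of_mem (by rw [disk, mem_ball_zero_iff, e2, hnr]; exact hr.2),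
            logWeight_congr α e2, smul_eq_mul]
          ring
        simp_rw [hint]
        rw [lintegral_const_mul' _ _ (ENNReal.mul_ne_top ENNReal.ofReal_ne_top
          ENNReal.ofReal_ne_top), ← ofReal_norm (r : ℂ), hnr]
        have h2 : ENNReal.ofReal (2 * Real.pi) * (ENNReal.ofReal (2 * Real.pi))⁻¹ = 1 :=
          ENNReal.mul_inv_cancel (by simpa using Real.pi_pos) ENNReal.ofReal_ne_top
        have h3 : ∀ A B D X Y : ℝ≥0∞, A * B = 1 → A * (X * (Y * (B * D))) = Y * X * D := by
          intro A B D X Y h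
          calc _ = (A * B) * (Y * X * D) := by ring
            _ = _ := by rw [h, one_mul]
        exact (h3 _ _ _ _ _ h2).symm
      · rw [indicator_of_notMem hr]
        by_cases hr0 : r ∈ Ioi (0 : ℝ)
        · rw [indicator_of_mem hr0, lintegral_eq_zero_of_ae_eq_zero]
          refine Eventually.of_forall fun θ => ?_
          have : Complex.polarCoord.symm (r, θ) ∉ disk := by
            rw [disk, mem_ball_zero_iff, Complex.norm_polarCoord_symm, abs_of_pos hr0]
            exact fun h => hr ⟨hr0, h⟩
          change _ • disk.indicator _ _ = 0
          rw [indicator_of_notMem this, smul_zero]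
        · rw [indicator_of_notMem hr0]
    · refine Measurable.aemeasurable ?_
      have hpm : Measurable fun q : ℝ × ℝ => Complex.polarCoord.symm q := by
        simp_rw [Complex.polarCoord_symm_apply]
        fun_prop
      exact (measurable_fst.ennreal_ofReal).smul
        (hmeas.comp hpm)
  have h2 : (ENNReal.ofReal Real.pi)⁻¹ * ENNReal.ofReal (2 * Real.pi) = 2 := by
    rw [mul_comm 2 Real.pi, ENNReal.ofReal_mul Real.pi_pos.le, ← mul_assoc,
      ENNReal.inv_mul_cancel (by simpa using Real.pi_pos) ENNReal.ofReal_ne_top, one_mul]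
    simp
  rw [blochOneNorm, key, ← mul_assoc, h2]

end Circle

/-! ### The norm of `𝔅¹` and the `ℓ¹` sum of the blocks. -/

section Mean

open MeasureTheory

/-- The radial density of the norm of `𝔅¹`. -/
noncomputable def radialDensity (α : ℝ) (f : ℂ → ℂ) (r : ℝ) : ℝ≥0∞ :=
  ENNReal.ofReal (logWeight α r) * ‖powerSum (eulerCoeff (circleCoeff (taylorCoeff f))) r‖ₑ

lemma IsHol.norm_powerSum_circle_eq {f : ℂ → ℂ} (hf : IsHol f) {w z : ℂ} (hw : w ∈ disk)
    (h : ‖w‖ = ‖z‖) : ‖powerSum (eulerCoeff (circleCoeff (taylorCoeff f))) w‖ =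
      ‖powerSum (eulerCoeff (circleCoeff (taylorCoeff f))) z‖ := by
  have hz : z ∈ disk := by rwa [disk, mem_ball_zero_iff, ← h, ← mem_ball_zero_iff]
  rw [← toReal_enorm, ← toReal_enorm, hf.enorm_powerSum_circle hw, hf.enorm_powerSum_circle hz,
    meanOne_eq_of_norm _ w, meanOne_eq_of_norm _ z, h, ← ofReal_norm w, ← ofReal_norm z, h]

/-- On the `m`-th dyadic interval the factor `1 / (1 - r) ≤ 2 * 2^m` is compensated by the length
`2^(-m) / 2`. What remains is the kernel applied to the block norms, and interchanging the sums
gives the `ℓ¹` estimate. -/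
theorem exists_lintegral_radialDensity_le {ω : ℝ → ℝ} (hω : IsCutoff ω) (α : ℝ) :
    ∃ C : ℝ≥0, ∀ f : ℂ → ℂ, IsHol f →
      ∫⁻ r in Ioo (0 : ℝ) 1, radialDensity α f r ≤ C * ∑' n, blockOne ω α f n := by
  obtain ⟨p, hp⟩ := exists_nat_ge |α|
  obtain ⟨C, h⟩ := exists_weight_mul_enorm_le hω hp
  obtain ⟨S, hS, -⟩ := exists_tsum_dyadicKernel_le p
  refine ⟨C * S, fun f hf => ?_⟩
  simp_rw [hω.blockOne_eq]
  set b : ℕ → ℝ≥0∞ := weightedBlock ω α (circleCoeff (taylorCoeff f)) with hb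
  set A : ℕ → Set ℝ := fun m => Icc (1 - (1 / 2) ^ m) (1 - (1 / 2) ^ m / 2) with hA
  have hcover : Ioo (0 : ℝ) 1 ⊆ ⋃ m, A m := fun r hr => by
    obtain ⟨m, h1, h2⟩ := exists_dyadic hr.1.le hr.2
    exact mem_iUnion.2 ⟨m, by linarith, by linarith⟩
  have hpt : ∀ m, ∀ r ∈ A m, radialDensity α f r ≤ ENNReal.ofReal (2 * 2 ^ m) *
      (C * ∑' n, ENNReal.ofReal (dyadicKernel p n m) * b n) := fun m r hr => by
    have hm0 : (0 : ℝ) < (1 / 2) ^ m := by positivity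
    have hm1 : (1 / 2 : ℝ) ^ m ≤ 1 := pow_le_one₀ (by norm_num) (by norm_num)
    have hr0 : 0 ≤ r := by linarith [hr.1]
    have hr1 : r < 1 := by linarith [hr.2]
    have hnr : ‖(r : ℂ)‖ = r := by simp [hr0]
    have hrd : (r : ℂ) ∈ disk := by rwa [disk, mem_ball_zero_iff, hnr]
    have key := h _ (circleCoeff (taylorCoeff f)) r m hrd
      (by rw [hnr]; exact hf.summable_eulerCoeff_circleCoeff hr0 hr1)
      (by rw [hnr]; linarith [hr.2]) (by rw [hnr]; linarith [hr.1])
    have h1 : (1 : ℝ) ≤ 2 * 2 ^ m * (1 - r) := by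
      have : (2 : ℝ) * 2 ^ m * ((1 / 2) ^ m / 2) = 1 := by
        rw [one_div, inv_pow]; field_simp
      rw [← this]
      gcongr
      linarith [hr.2]
    have hl := logWeight_nonneg α hrd
    calc radialDensity α f r ≤ ENNReal.ofReal (2 * 2 ^ m) *
          (ENNReal.ofReal ((1 - ‖(r : ℂ)‖) * logWeight α r) *
            ‖powerSum (eulerCoeff (circleCoeff (taylorCoeff f))) r‖ₑ) := by
          rw [radialDensity, ← mul_assoc, ← ENNReal.ofReal_mul (by positivity), hnr]
          gcongr
          nlinarith
      _ ≤ ENNReal.ofReal (2 * 2 ^ m) * (‖(r : ℂ)‖ₑ *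
          (C * ∑' n, ENNReal.ofReal (dyadicKernel p n m) * b n)) := by gcongr
      _ ≤ _ := by
          refine mul_le_mul' le_rfl (mul_le_of_le_one_left' ?_)
          rw [← ofReal_norm, hnr, ← ENNReal.ofReal_one]
          exact ENNReal.ofReal_le_ofReal hr1.le
  have hint : ∀ m, ∫⁻ r in A m, radialDensity α f r ≤
      C * ∑' n, ENNReal.ofReal (dyadicKernel p n m) * b n := fun m => by
    calc _ ≤ ∫⁻ _ in A m, ENNReal.ofReal (2 * 2 ^ m) *
          (C * ∑' n, ENNReal.ofReal (dyadicKernel p n m) * b n) :=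
          setLIntegral_mono' measurableSet_Icc (hpt m)
      _ = (ENNReal.ofReal (2 * 2 ^ m) * ENNReal.ofReal ((1 / 2) ^ m / 2)) *
          (C * ∑' n, ENNReal.ofReal (dyadicKernel p n m) * b n) := by
          rw [setLIntegral_const, Real.volume_Icc]
          have : (1 - (1 / 2 : ℝ) ^ m / 2) - (1 - (1 / 2) ^ m) = (1 / 2) ^ m / 2 := by ring
          rw [this]; ring
      _ = _ := by
          rw [← ENNReal.ofReal_mul (by positivity)]
          have : (2 : ℝ) * 2 ^ m * ((1 / 2) ^ m / 2) = 1 := by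
            rw [one_div, inv_pow]; field_simp
          rw [this, ENNReal.ofReal_one, one_mul]
  calc _ ≤ ∫⁻ r in ⋃ m, A m, radialDensity α f r := lintegral_mono_set hcover
    _ ≤ ∑' m, ∫⁻ r in A m, radialDensity α f r := lintegral_iUnion_le _ _
    _ ≤ ∑' m, C * ∑' n, ENNReal.ofReal (dyadicKernel p n m) * b n := ENNReal.tsum_le_tsum hint
    _ = C * ∑' n, (∑' m, ENNReal.ofReal (dyadicKernel p n m)) * b n := by
        rw [ENNReal.tsum_mul_left, ENNReal.tsum_comm]
        simp_rw [ENNReal.tsum_mul_right]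
    _ ≤ C * ∑' n, S * b n := by
        gcongr with n
        exact hS n
    _ = _ := by rw [ENNReal.tsum_mul_left, ENNReal.coe_mul, mul_assoc]

/-- A lower bound for the length of the interval between consecutive radii `exp (-2^(-n))`. -/
lemma exp_sub_exp_ge {x : ℝ} (h0 : 0 ≤ x) (h1 : x ≤ 1) :
    x / 6 ≤ Real.exp (-(x / 2)) - Real.exp (-x) := by
  have e : Real.exp (-(x / 2)) = Real.exp (-x) * Real.exp (x / 2) := by
    rw [← Real.exp_add]; ring_nf
  have h2 := Real.add_one_le_exp (x / 2)
  have h3 : (1 / 3 : ℝ) ≤ Real.exp (-x) := by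
    have h4 : Real.exp (-1) ≤ Real.exp (-x) := Real.exp_le_exp.2 (by linarith)
    refine le_trans ?_ h4
    rw [Real.exp_neg, ← one_div]
    exact one_div_le_one_div_of_le (Real.exp_pos _) Real.exp_one_lt_three.le
  rw [e]
  nlinarith

/-- The radius `exp (-2^(-n))`. -/
noncomputable def dyadicRadius (n : ℕ) : ℝ := Real.exp (-(1 / 2 ^ n))

lemma dyadicRadius_succ (n : ℕ) : dyadicRadius (n + 1) = Real.exp (-(1 / 2 ^ n / 2)) := by
  rw [dyadicRadius, pow_succ, div_div]

lemma monotone_dyadicRadius : Monotone dyadicRadius := by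
  refine monotone_nat_of_le_succ fun n => ?_
  rw [dyadicRadius_succ, dyadicRadius]
  have : (0 : ℝ) < 1 / 2 ^ n := by positivity
  exact Real.exp_le_exp.2 (by linarith)

/-- Integrating a pointwise bound over a dyadic annulus. -/
lemma le_lintegral_dyadic {c : ℝ≥0∞} {D : ℝ≥0} {F : ℝ → ℝ≥0∞} (n : ℕ)
    (h : ∀ r ∈ Ico (dyadicRadius n) (dyadicRadius (n + 1)),
      c ≤ D * ENNReal.ofReal ((1 / 2) ^ n) * F r) :
    c ≤ (6 * D : ℝ≥0) * ∫⁻ r in Ico (dyadicRadius n) (dyadicRadius (n + 1)), F r := by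
  set I := ∫⁻ r in Ico (dyadicRadius n) (dyadicRadius (n + 1)), F r with hI
  have hx0 : (0 : ℝ) < (1 / 2) ^ n := by positivity
  have h1 : c * ENNReal.ofReal ((1 / 2) ^ n / 6) ≤ D * ENNReal.ofReal ((1 / 2) ^ n) * I := by
    calc _ ≤ c * volume (Ico (dyadicRadius n) (dyadicRadius (n + 1))) := by
          gcongr
          rw [Real.volume_Ico, dyadicRadius_succ, dyadicRadius]
          have e : (1 : ℝ) / 2 ^ n = (1 / 2) ^ n := by rw [div_pow, one_pow]
          rw [e]
          exact ENNReal.ofReal_le_ofReal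
            (exp_sub_exp_ge hx0.le (pow_le_one₀ (by norm_num) (by norm_num)))
      _ = ∫⁻ _ in Ico (dyadicRadius n) (dyadicRadius (n + 1)), c := (setLIntegral_const _ _).symm
      _ ≤ ∫⁻ r in Ico (dyadicRadius n) (dyadicRadius (n + 1)),
          D * ENNReal.ofReal ((1 / 2) ^ n) * F r := setLIntegral_mono' measurableSet_Ico h
      _ = _ := lintegral_const_mul' _ _ (ENNReal.mul_ne_top ENNReal.coe_ne_top ENNReal.ofReal_ne_top)
  have h2 : ENNReal.ofReal ((1 / 2) ^ n / 6) * ENNReal.ofReal (6 * 2 ^ n) = 1 := by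
    rw [← ENNReal.ofReal_mul (by positivity), ← ENNReal.ofReal_one]
    congr 1
    rw [one_div, inv_pow]; field_simp
  have h3 : ENNReal.ofReal ((1 / 2) ^ n) * ENNReal.ofReal (6 * 2 ^ n) = 6 := by
    rw [← ENNReal.ofReal_mul (by positivity), ← ENNReal.ofReal_ofNat]
    congr 1
    rw [one_div, inv_pow]; field_simp
  calc c = c * ENNReal.ofReal ((1 / 2) ^ n / 6) * ENNReal.ofReal (6 * 2 ^ n) := by
        rw [mul_assoc, h2, mul_one]
    _ ≤ D * ENNReal.ofReal ((1 / 2) ^ n) * I * ENNReal.ofReal (6 * 2 ^ n) := by gcongr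
    _ = (ENNReal.ofReal ((1 / 2) ^ n) * ENNReal.ofReal (6 * 2 ^ n)) * D * I := by ring
    _ = _ := by rw [h3]; push_cast; ring

/-- The block `n + 1` is bounded at every radius of the `n`-th interval, hence by the integral over
it, and these intervals are disjoint. The block `0` needs only `f 0` and the coefficient of index
`1`. -/
theorem exists_tsum_blockOne_le {ω : ℝ → ℝ} (hω : IsCutoff ω) (α : ℝ) :
    ∃ C : ℝ≥0, ∀ f : ℂ → ℂ, IsHol f →
      ∑' n, blockOne ω α f n ≤ ‖f 0‖ₑ + C * ∫⁻ r in Ioo (0 : ℝ) 1, radialDensity α f r := by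
  obtain ⟨p, hp⟩ := exists_nat_ge |α|
  obtain ⟨C, h⟩ := exists_weightedBlock_succ_le hω hp
  -- Cauchy's estimate divides by `r ≥ e⁻¹ ≥ 1/3`; the factor `4 ^ p` compares the weight with `1`
  -- on the interval `n = 0`.
  set C0 : ℝ≥0 := (3 * 4 ^ p) with hC0
  refine ⟨6 * C + 6 * C0, fun f hf => ?_⟩
  simp_rw [hω.blockOne_eq]
  set x := circleCoeff (taylorCoeff f) with hx
  set I := ∫⁻ r in Ioo (0 : ℝ) 1, radialDensity α f r with hI
  set A : ℕ → Set ℝ := fun n => Ico (dyadicRadius n) (dyadicRadius (n + 1)) with hA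
  have hmem : ∀ n, ∀ r ∈ A n, 0 < r ∧ r < 1 ∧ ‖(r : ℂ)‖ = r ∧ (r : ℂ) ∈ disk ∧
      (1 / 2 : ℝ) ^ n / 4 ≤ 1 - r ∧ 1 - r ≤ (1 / 2 : ℝ) ^ n := fun n r hr => by
    obtain ⟨h1, h2⟩ := hr
    have h0 : 0 < r := (Real.exp_pos _).trans_le h1
    rw [dyadicRadius_succ] at h2
    obtain ⟨h3, h4⟩ := one_sub_bounds h1 h2.le
    have hx0 : (0 : ℝ) < (1 / 2) ^ n := by positivity
    have hnr : ‖(r : ℂ)‖ = r := by simp [h0.le]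
    exact ⟨h0, by linarith, hnr, by rw [disk, mem_ball_zero_iff, hnr]; linarith, h3, h4⟩
  have hbound : ∀ r : ℝ, (r : ℂ) ∈ disk → 0 < r → ∀ w, ‖w‖ = r →
      ‖powerSum (eulerCoeff x) w‖ ≤ ‖powerSum (eulerCoeff x) (r : ℂ)‖ := fun r hr h0 w hw => by
    have hnr : ‖(r : ℂ)‖ = r := by simp [h0.le]
    refine (hf.norm_powerSum_circle_eq (z := r) ?_ ?_).le
    · rwa [disk, mem_ball_zero_iff, hw, ← hnr, ← mem_ball_zero_iff]
    · rw [hw, hnr]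
  have hsucc : ∀ n, weightedBlock ω α x (n + 1) ≤
      (6 * C : ℝ≥0) * ∫⁻ r in A n, radialDensity α f r := fun n => by
    refine le_lintegral_dyadic n fun r hr => ?_
    obtain ⟨h0, h1, hnr, hrd, h3, h4⟩ := hmem n r hr
    refine (h _ x n r ‖powerSum (eulerCoeff x) (r : ℂ)‖ hr.1
      (by rw [← dyadicRadius_succ]; exact hr.2.le)
      (hf.summable_eulerCoeff_circleCoeff h0.le h1) (hbound r hrd h0)).trans ?_
    have hl := logWeight_nonneg α hrd
    rw [mul_assoc, ENNReal.ofReal_mul (by linarith), ENNReal.ofReal_mul hl, ofReal_norm,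
      radialDensity, mul_assoc]
    gcongr
  have hunion : ∑' n, ∫⁻ r in A n, radialDensity α f r ≤ I := by
    have hdisj : Pairwise (Function.onFun Disjoint A) :=
      monotone_dyadicRadius.pairwise_disjoint_on_Ico_succ
    rw [← lintegral_iUnion (fun n => measurableSet_Ico) hdisj]
    refine lintegral_mono_set (iUnion_subset fun n r hr => ?_)
    obtain ⟨h0, h1, -⟩ := hmem n r hr
    exact ⟨h0, h1⟩
  have hx0 : ‖x 0‖ₑ = ‖f 0‖ₑ := by
    rw [← ofReal_norm, hx, norm_circleCoeff, taylorCoeff_zero, ofReal_norm]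
  have hx1 : ‖x 1‖ₑ ≤ (6 * C0 : ℝ≥0) * I := by
    refine (le_lintegral_dyadic (D := C0) (F := radialDensity α f) 0 fun r hr => ?_).trans ?_
    · obtain ⟨h0, h1, hnr, hrd, h3, h4⟩ := hmem 0 r hr
      have hc := norm_coeff_le (hf.summable_eulerCoeff_circleCoeff h0.le h1) h0.le
        (hbound r hrd h0) 1
      rw [pow_one, eulerCoeff, Nat.cast_one, one_smul, ← hx] at hc
      have hq := (logWeight_comparable hp (z := (r : ℂ)) (m := 0) (by rwa [hnr]) (by rwa [hnr])
        (q := 1) (by simp) (by norm_num)).2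
      rw [Real.one_rpow] at hq
      have hr3 : 1 ≤ 3 * r := by
        have : Real.exp (-1) ≤ r := by simpa [dyadicRadius] using hr.1
        have h5 : (1 / 3 : ℝ) ≤ Real.exp (-1) := by
          rw [Real.exp_neg, ← one_div]
          exact one_div_le_one_div_of_le (Real.exp_pos _) Real.exp_one_lt_three.le
        linarith
      have hreal : ‖x 1‖ ≤ (3 * 4 ^ p) *
          (logWeight α r * ‖powerSum (eulerCoeff x) (r : ℂ)‖) := by
        calc ‖x 1‖ ≤ (3 * r) * ‖x 1‖ := le_mul_of_one_le_left (norm_nonneg _) hr3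
          _ = 1 * (3 * (r * ‖x 1‖)) := by ring
          _ ≤ (4 ^ p * logWeight α r) * (3 * ‖powerSum (eulerCoeff x) (r : ℂ)‖) := by
              gcongr
          _ = _ := by ring
      rw [pow_zero, ENNReal.ofReal_one, mul_one, radialDensity, ← ofReal_norm, ← ofReal_norm,
        ← ENNReal.ofReal_mul (logWeight_nonneg α hrd), ← ENNReal.ofReal_coe_nnreal,
        ← ENNReal.ofReal_mul (NNReal.coe_nonneg _)]
      refine ENNReal.ofReal_le_ofReal (hreal.trans_eq ?_)
      simp [hC0, hx]
    · gcongr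
      exact (ENNReal.le_tsum (f := fun n => ∫⁻ r in A n, radialDensity α f r) 0).trans hunion
  rw [tsum_eq_zero_add' ENNReal.summable]
  calc _ ≤ (‖f 0‖ₑ + (6 * C0 : ℝ≥0) * I) +
        ∑' n, (6 * C : ℝ≥0) * ∫⁻ r in A n, radialDensity α f r := by
        refine add_le_add ((weightedBlock_zero_le hω α x).trans ?_) (ENNReal.tsum_le_tsum hsucc)
        rw [hx0]
        gcongr
    _ ≤ (‖f 0‖ₑ + (6 * C0 : ℝ≥0) * I) + (6 * C : ℝ≥0) * I := by
        rw [ENNReal.tsum_mul_left]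
        gcongr
    _ = _ := by push_cast; ring

theorem exists_blochOneNorm_comparable {ω : ℝ → ℝ} (hω : IsCutoff ω) (α : ℝ) :
    ∃ C : ℝ≥0, 0 < C ∧ ∀ f : ℂ → ℂ, IsHol f →
      blochOneNorm α f ≤ C * (∑' n, blockOne ω α f n) ∧
      (∑' n, blockOne ω α f n) ≤ C * blochOneNorm α f := by
  obtain ⟨C1, h1⟩ := exists_lintegral_radialDensity_le hω α
  obtain ⟨C2, h2⟩ := exists_tsum_blockOne_le hω α
  refine ⟨1 + 2 * C1 + C2, by positivity, fun f hf => ⟨?_, ?_⟩⟩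
  · rw [hf.blochOneNorm_eq]
    have e1 : ‖f 0‖ₑ ≤ ∑' n, blockOne ω α f n := by
      refine le_trans ?_ (ENNReal.le_tsum 0)
      rw [hω.blockOne_eq]
      refine le_trans (le_of_eq ?_) (enorm_coeff_zero_le hω α _)
      rw [← ofReal_norm, ← ofReal_norm, norm_circleCoeff, taylorCoeff_zero]
    calc _ ≤ (∑' n, blockOne ω α f n) + 2 * (C1 * ∑' n, blockOne ω α f n) := by
          gcongr
          exact h1 f hf
      _ = ((1 + 2 * C1 : ℝ≥0) : ℝ≥0∞) * ∑' n, blockOne ω α f n := by push_cast; ring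
      _ ≤ _ := mul_le_mul' (ENNReal.coe_le_coe.2 le_self_add) le_rfl
  · refine (h2 f hf).trans ?_
    rw [hf.blochOneNorm_eq]
    change _ ≤ _ * (_ + 2 * ∫⁻ r in Ioo (0 : ℝ) 1, radialDensity α f r)
    set I := ∫⁻ r in Ioo (0 : ℝ) 1, radialDensity α f r
    calc _ ≤ (‖f 0‖ₑ + 2 * I) + C2 * (‖f 0‖ₑ + 2 * I) := by
          refine add_le_add le_self_add ?_
          gcongr
          refine le_trans ?_ le_add_self
          rw [two_mul]
          exact le_self_add
      _ = ((1 + C2 : ℝ≥0) : ℝ≥0∞) * (‖f 0‖ₑ + 2 * I) := by push_cast; ring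
      _ ≤ _ := mul_le_mul' (ENNReal.coe_le_coe.2
          (le_of_le_of_eq (le_self_add (b := 2 * C1)) (by ring))) le_rfl

end Mean

end LogBloch

/-! ### Assembly of the final statement. -/

lemma LogBloch.comparable_lt_top_iff {C : ℝ≥0} {a b : ℝ≥0∞} (h1 : a ≤ C * b) (h2 : b ≤ C * a) :
    a < ∞ ↔ b < ∞ :=
  ⟨fun h => h2.trans_lt (ENNReal.mul_lt_top ENNReal.coe_lt_top h),
    fun h => h1.trans_lt (ENNReal.mul_lt_top ENNReal.coe_lt_top h)⟩

lemma LogBloch.inv_mul_le_of_le_mul {C : ℝ≥0} (hC : 0 < C) {a b : ℝ≥0∞} (h : a ≤ C * b) :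
    (C : ℝ≥0∞)⁻¹ * a ≤ b := by
  calc (C : ℝ≥0∞)⁻¹ * a ≤ (C : ℝ≥0∞)⁻¹ * (C * b) := by gcongr
    _ = b := by
      rw [← mul_assoc, ENNReal.inv_mul_cancel (by exact_mod_cast hC.ne') ENNReal.coe_ne_top,
        one_mul]

theorem mainTheorem4 (ω : ℝ → ℝ) (hω : LogBloch.IsCutoff ω) (α : ℝ) :
    (∀ f : ℂ → ℂ, LogBloch.IsHol f →
      (LogBloch.MemBloch α f ↔ (⨆ n, LogBloch.blockInf ω α f n) < ∞) ∧
      (LogBloch.MemLittleBloch α f ↔ Tendsto (LogBloch.blockInf ω α f) atTop (𝓝 0)) ∧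
      (LogBloch.MemBlochOne α f ↔ (∑' n, LogBloch.blockOne ω α f n) < ∞)) ∧
    (∃ C : ℝ≥0, 0 < C ∧ ∀ f : ℂ → ℂ, LogBloch.IsHol f →
      (C : ℝ≥0∞)⁻¹ * LogBloch.blochNorm α f ≤ (⨆ n, LogBloch.blockInf ω α f n) ∧
      (⨆ n, LogBloch.blockInf ω α f n) ≤ C * LogBloch.blochNorm α f) ∧
    (∃ C : ℝ≥0, 0 < C ∧ ∀ f : ℂ → ℂ, LogBloch.IsHol f →
      (C : ℝ≥0∞)⁻¹ * LogBloch.blochOneNorm α f ≤ (∑' n, LogBloch.blockOne ω α f n) ∧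
      (∑' n, LogBloch.blockOne ω α f n) ≤ C * LogBloch.blochOneNorm α f) := by
  obtain ⟨C, hC, h⟩ := LogBloch.exists_blochNorm_comparable hω α
  obtain ⟨D, hD, h'⟩ := LogBloch.exists_blochOneNorm_comparable hω α
  refine ⟨fun f hf => ⟨?_, LogBloch.memLittleBloch_iff hω α hf, ?_⟩,
    ⟨C, hC, fun f hf => ⟨LogBloch.inv_mul_le_of_le_mul hC (h f hf).1, (h f hf).2⟩⟩,
    ⟨D, hD, fun f hf => ⟨LogBloch.inv_mul_le_of_le_mul hD (h' f hf).1, (h' f hf).2⟩⟩⟩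
  · rw [hf.memBloch_iff, LogBloch.comparable_lt_top_iff (h f hf).1 (h f hf).2]
  · rw [LogBloch.MemBlochOne, and_iff_right hf,
      LogBloch.comparable_lt_top_iff (h' f hf).1 (h' f hf).2]
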